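/- Graphs are finite and loopless; multiple edges are allowed. A graph is $m$-tree-connected if it has $m$ pairwise edge-disjoint spanning trees (the null graph, with no vertices, is not $m$-tree-connected). The $m$-tree-connected components of a graph $H$ are its maximal induced $m$-tree-connected subgraphs; their vertex sets partition $V(H)$. Put $$\Omega(H)=|P|-\tfrac12\,e_H(P),$$ where $P$ is the partition of $V(H)$ into the vertex sets of the $2$-tree-connected components of $H$, and $e_H(P)$ is the number of edges of $H$ whose ends lie in different parts of $P$ (so $\Omega=0$ for the null graph). For $S\subseteq V(G)$, let $G\setminus S$ be the graph obtained from $G$ by removing the vertices of $S$, and let $e_G(S)$ be the number of edges of $G$ with both ends in $S$. Theorem. Let $G$ be a $2$-tree-connected graph, let $\lambda\in[0,1/2]$ be a real number, and let $f$ be a positive integer-valued function on $V(G)$. Suppose that for every $S\subseteq V(G)$, $$\Omega(G\setminus S)<\sum_{v\in S}\Big(f(v)+2\lambda-\frac32\Big)+\frac52-\lambda\,\big(e_G(S)+2\big).$$ Then $G$ has a spanning closed trail (a closed walk that uses no edge more than once and meets every vertex) that meets each vertex $v$ at most $f(v)$ times, where the coinciding first and last vertex of the trail is counted once for the closing, and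 the trivial closed trail on a single vertex meets that vertex once. -/

import Mathlib

namespace Graph

/-- A walk from `x` to `y` in a multigraph: an alternating sequence of vertices and edges. -/
inductive Walk {α β : Type*} (G : Graph α β) : α → α → Type _
  | nil (x : α) (hx : x ∈ G.vertexSet) : Walk G x x
  | cons {y z : α} (x : α) (e : β) (h : G.IsLink e x y) (p : Walk G y z) : Walk G x z

namespace Walk

/-- The edges traversed by a walk, in order. -/
def edges {α β : Type*} {G : Graph α β} {x y : α} : G.Walk x y → List β
  | nil _ _ => []
  | cons _ e _ p => e :: p.edges

/-- The sequence of vertices of a walk, with both its first and its last vertex. -/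
def support {α β : Type*} {G : Graph α β} {x y : α} : G.Walk x y → List α
  | nil x _ => [x]
  | cons x _ _ p => x :: p.support

/-- The sequence of vertices of a closed walk read cyclically: the common first and last vertex is
listed once only for the closing of the walk. The trivial walk consists of its single vertex. -/
def cyclicSupport {α β : Type*} {G : Graph α β} {x y : α} : G.Walk x y → List α
  | nil x _ => [x]
  | cons _ _ _ p => p.support

/-- A trail is a walk that uses no edge more than once. -/
def IsTrail {α β : Type*} {G : Graph α β} {x y : α} (p : G.Walk x y) : Prop :=
  p.edges.Nodup

/-- A cycle is a closed trail with at least one edge that repeats no vertex. -/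
def IsCycle {α β : Type*} {G : Graph α β} {x : α} (p : G.Walk x x) : Prop :=
  p.edges ≠ [] ∧ p.IsTrail ∧ p.cyclicSupport.Nodup

open Classical in
/-- The number of times that a closed walk meets the vertex `v`. -/
noncomputable def visits {α β : Type*} {G : Graph α β} {x : α} (p : G.Walk x x) (v : α) : ℕ :=
  p.cyclicSupport.count v

end Walk

/-- A spanning closed trail that meets each vertex `v` at most `f v` times. -/
def HasSpanningClosedTrail {α β : Type*} (G : Graph α β) (f : α → ℕ) : Prop :=
  ∃ (x : α) (p : G.Walk x x), p.IsTrail ∧ ∀ v ∈ G.vertexSet, 1 ≤ p.visits v ∧ p.visits v ≤ f v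

/-- A connected graph; the null graph is not connected. -/
def IsConnected {α β : Type*} (G : Graph α β) : Prop :=
  G.vertexSet.Nonempty ∧ ∀ x ∈ G.vertexSet, ∀ y ∈ G.vertexSet, Nonempty (G.Walk x y)

/-- A tree: a connected graph without cycles. -/
def IsTree {α β : Type*} (G : Graph α β) : Prop :=
  G.IsConnected ∧ ∀ (x : α) (p : G.Walk x x), ¬ p.IsCycle

/-- A graph is `m`-tree-connected if it has `m` pairwise edge-disjoint spanning trees. -/
def IsTreeConnected {α β : Type*} (m : ℕ) (G : Graph α β) : Prop :=
  ∃ T : Fin m → Graph α β, (∀ i, (T i).IsSpanningSubgraph G ∧ (T i).IsTree) ∧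
    ∀ i j, i ≠ j → Disjoint (T i).edgeSet (T j).edgeSet

/-- The partition of the vertex set into the vertex sets of the `m`-tree-connected components,
which are the maximal induced `m`-tree-connected subgraphs. -/
def treeComponents {α β : Type*} (m : ℕ) (G : Graph α β) : Set (Set α) :=
  {C | Maximal (fun X : Set α => X ⊆ G.vertexSet ∧ IsTreeConnected m (G.induce X)) C}

/-- The number of edges whose ends lie in different parts of `P`. -/
noncomputable def crossEdges {α β : Type*} (G : Graph α β) (P : Set (Set α)) : ℕ :=
  {e : β | ∃ x y : α, G.IsLink e x y ∧ ∃ A ∈ P, ∃ B ∈ P, A ≠ B ∧ x ∈ A ∧ y ∈ B}.ncard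

/-- The number of edges with both ends in `S`. -/
noncomputable def insideEdges {α β : Type*} (G : Graph α β) (S : Set α) : ℕ :=
  {e : β | ∃ x ∈ S, ∃ y ∈ S, G.IsLink e x y}.ncard

/-- The tree-connectivity measure `Ω_m(G) = |P| - e_G(P) / m`, where `P` is the partition of the
vertex set into the `m`-tree-connected components. -/
noncomputable def treeOmega {α β : Type*} (m : ℕ) (G : Graph α β) : ℝ :=
  ((treeComponents m G).ncard : ℝ) - (1 / (m : ℝ)) * (G.crossEdges (treeComponents m G) : ℝ)

end Graph

/-!
Call a set `B` of edges sparse if every nonempty set `X` of vertices spans at most `2 * (#X - 1)`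
edges of `B`; by Nash-Williams these are the unions of two forests. A base is a sparse set that
attains the bound on `V`, that is, a union of two edge-disjoint spanning trees.

If some base `B` satisfies `deg B v ≤ 2 * f v + 1` for all `v`, then adding to its first tree a
suitable part of its second tree makes all degrees even, and an Euler tour of the resulting
connected graph meets each `v` at most `deg B v / 2`, hence at most `f v`, times.

Otherwise take a base `B` of least total excess over these bounds. Starting from the vertices of
positive excess and repeatedly adding the vertices of degree at least `2 * f v + 1` whose degree
cannot be lowered by an exchange of `B` away from the vertices already found, one reaches a set `S`
such that the edges of `B` avoiding `S` span all edges of `G \ S` in the sparsity matroid. Then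
`Ω(G \ S) = #(V \ S) - #B_S / 2`, where `B_S` consists of the edges of `B` avoiding `S`. The degrees
on `S` and the two bounds `2 * #S - 2` and `e_G(S)` on the number of edges of `B` inside `S`, taken
with weights `1 / 2 - lam` and `lam`, contradict the hypothesis.
-/

namespace TreeConnectivity

open Finset
open Function (update update_of_ne update_self)

variable {α β : Type*} {g : β → Finset α} {B B' E : Finset β} {X Y Z V : Finset α} {k : ℕ}

/-! ### Sparse edge sets and tight vertex sets -/

section SparseSets

/-- The edges in `E` form a loopless multigraph on the vertex set `V`. Multigraphs are encoded by
the map `g` that assigns to each edge its set of ends. -/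
def IsMultigraph (g : β → Finset α) (E : Finset β) (V : Finset α) : Prop :=
  ∀ e ∈ E, g e ⊆ V ∧ #(g e) = 2

lemma IsMultigraph.mono (hB : IsMultigraph g B' V) (h : B ⊆ B') : IsMultigraph g B V :=
  fun e he => hB e (h he)

lemma update_eq_of_mem [DecidableEq β] {p : β} {s : Finset α} (hp : p ∉ B) :
    ∀ e ∈ B, update g p s e = g e :=
  fun _ he => update_of_ne (ne_of_mem_of_not_mem he hp) _ _

variable [DecidableEq α]

/-- The edges of `B` with all ends in `X`. -/
def inside (g : β → Finset α) (B : Finset β) (X : Finset α) : Finset β :=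
  {e ∈ B | g e ⊆ X}

/-- The degree of the vertex `v` in the multigraph with edge set `B`. -/
def deg (g : β → Finset α) (B : Finset β) (v : α) : ℕ :=
  #{e ∈ B | v ∈ g e}

/-- An edge set `B` is `k`-sparse if every nonempty vertex set `X` spans at most `k (|X| - 1)` edges
of `B`; these are the independent sets of the union of `k` graphic matroids. The inequality is
rearranged to avoid subtraction. -/
def Sparse (k : ℕ) (g : β → Finset α) (B : Finset β) : Prop :=
  ∀ X : Finset α, X.Nonempty → #(inside g B X) + k ≤ k * #X

/-- A nonempty vertex set `X` is `k`-tight in `B` if it spans exactly `k (|X| - 1)` edges of `B`. -/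
def Tight (k : ℕ) (g : β → Finset α) (B : Finset β) (X : Finset α) : Prop :=
  X.Nonempty ∧ #(inside g B X) + k = k * #X

lemma mem_inside {e : β} : e ∈ inside g B X ↔ e ∈ B ∧ g e ⊆ X := mem_filter

lemma inside_mono (h : B ⊆ B') (hX : X ⊆ Y) : inside g B X ⊆ inside g B' Y := fun _ he =>
  mem_inside.2 ⟨h (mem_inside.1 he).1, (mem_inside.1 he).2.trans hX⟩

lemma inside_eq_self (h : ∀ e ∈ B, g e ⊆ X) : inside g B X = B :=
  filter_true_of_mem h

lemma inside_eq_empty_of_card_le_one (hB : ∀ e ∈ B, #(g e) = 2) (hX : #X ≤ 1) :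
    inside g B X = ∅ :=
  filter_false_of_mem fun e he h => by linarith [card_le_card h, hB e he]

lemma inside_union [DecidableEq β] : inside g (B ∪ B') X = inside g B X ∪ inside g B' X :=
  filter_union ..

lemma inside_inter [DecidableEq β] : inside g B X ∩ inside g B Y = inside g B (X ∩ Y) := by
  ext e
  simp only [mem_inter, mem_inside, subset_inter_iff]
  tauto

lemma inside_erase [DecidableEq β] {b : β} : inside g (B.erase b) X = (inside g B X).erase b :=
  filter_erase ..

lemma inside_insert_of_subset [DecidableEq β] {e : β} (h : g e ⊆ X) :
    inside g (insert e B) X = insert e (inside g B X) := by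
  rw [inside, filter_insert, if_pos h, inside]

lemma inside_insert_of_not_subset [DecidableEq β] {e : β} (h : ¬ g e ⊆ X) :
    inside g (insert e B) X = inside g B X := by
  rw [inside, filter_insert, if_neg h, inside]

lemma inside_erase_vertex {v : α} (hv : ∀ e ∈ B, v ∉ g e) :
    inside g B (X.erase v) = inside g B X :=
  filter_congr fun e he => by simp [subset_erase, hv e he]

lemma card_inside_add_card_inside_le :
    #(inside g B X) + #(inside g B Y) ≤ #(inside g B (X ∪ Y)) + #(inside g B (X ∩ Y)) := by
  classical
  rw [← card_union_add_card_inter, inside_inter]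
  exact Nat.add_le_add_right (card_le_card (union_subset
    (inside_mono subset_rfl subset_union_left) (inside_mono subset_rfl subset_union_right))) _

lemma mul_card_union_add_mul_card_inter (k : ℕ) (X Y : Finset α) :
    k * #(X ∪ Y) + k * #(X ∩ Y) = k * #X + k * #Y := by
  rw [← mul_add, card_union_add_card_inter, mul_add]

lemma card_inside_eq_add (hXZ : X ⊆ Z) :
    #(inside g B Z) = #(inside g B X) + #{e ∈ B | g e ⊆ Z ∧ ¬ g e ⊆ X} := by
  classical
  rw [← card_filter_add_card_filter_not (s := inside g B Z) (fun e => g e ⊆ X)]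
  simp only [inside, filter_filter]
  congr 2
  exact filter_congr fun e _ => ⟨And.right, fun h => ⟨h.trans hXZ, h⟩⟩

lemma sum_deg (hB : IsMultigraph g B V) : ∑ v ∈ V, deg g B v = 2 * #B := by
  have hends : ∀ e ∈ B, #(bipartiteBelow (fun v e => v ∈ g e) V e) = 2 := fun e he => by
    rw [bipartiteBelow, filter_mem_eq_inter, inter_eq_right.2 (hB e he).1, (hB e he).2]
  rw [mul_comm, ← smul_eq_mul, ← sum_const, ← sum_congr rfl hends]
  exact sum_card_bipartiteAbove_eq_sum_card_bipartiteBelow _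

lemma deg_exchange [DecidableEq β] {e b : β} (he : e ∉ B) (hb : b ∈ B) (v : α) :
    deg g (insert e (B.erase b)) v + (if v ∈ g b then 1 else 0)
      = deg g B v + (if v ∈ g e then 1 else 0) := by
  have hinsert {C : Finset β} {c : β} (hc : c ∉ C) :
      deg g (insert c C) v = deg g C v + if v ∈ g c then 1 else 0 := by
    simp only [deg, filter_insert]
    split_ifs with h
    · exact card_insert_of_notMem fun h' => hc (mem_filter.1 h').1
    · rfl
  have hB := hinsert (notMem_erase b B)
  rw [insert_erase hb] at hB
  have hB' := hinsert (C := B.erase b) fun h => he (mem_of_mem_erase h)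
  omega

namespace Sparse

lemma mono (hB : Sparse k g B') (h : B ⊆ B') : Sparse k g B := fun X hX =>
  (Nat.add_le_add_right (card_le_card (inside_mono h subset_rfl)) k).trans (hB X hX)

lemma insert_of_not_tight [DecidableEq β] (hB : Sparse k g B) {e : β}
    (h : ∀ X, Tight k g B X → ¬ g e ⊆ X) : Sparse k g (insert e B) := by
  intro X hX
  have hBX := hB X hX
  by_cases heX : g e ⊆ X
  · have hne : #(inside g B X) + k ≠ k * #X := fun h' => h X ⟨hX, h'⟩ heX
    have := card_insert_le e (inside g B X)
    rw [inside_insert_of_subset heX]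
    omega
  · rwa [inside_insert_of_not_subset heX]

lemma union_star [DecidableEq β] {D : Finset β} {v : α} (hB : Sparse k g B)
    (hv : ∀ e ∈ B, v ∉ g e) (hD : ∀ e ∈ D, v ∈ g e ∧ #(g e) = 2) (hDk : #D ≤ k) :
    Sparse k g (D ∪ B) := by
  intro X hX
  rw [inside_union]
  have hunion := card_union_le (inside g D X) (inside g B X)
  by_cases hvX : v ∈ X
  · rcases eq_singleton_or_nontrivial hvX with rfl | hX2
    · have hB1 := hB {v} hX
      rw [inside_eq_empty_of_card_le_one (fun e he => (hD e he).2) (by simp)] at hunion ⊢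
      simpa using hB1
    · have hBX := hB _ (hX2.erase_nonempty (a := v))
      have hDX : #(inside g D X) ≤ #D := card_filter_le _ _
      rw [inside_erase_vertex hv, card_erase_of_mem hvX, Nat.mul_sub_one] at hBX
      have := Nat.le_mul_of_pos_right k hX.card_pos
      omega
  · have hDX : inside g D X = ∅ := filter_false_of_mem fun e he h => hvX (h (hD e he).1)
    rw [hDX, empty_union]
    exact hB X hX

end Sparse

lemma sparse_empty : Sparse k g (∅ : Finset β) := fun X hX => by
  simpa [inside] using Nat.le_mul_of_pos_right k hX.card_pos

lemma tight_singleton (hB : ∀ e ∈ B, #(g e) = 2) (v : α) : Tight k g B {v} := by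
  refine ⟨singleton_nonempty v, ?_⟩
  rw [inside_eq_empty_of_card_le_one hB (card_singleton v).le]
  simp

lemma Tight.union_inter (hB : Sparse k g B) (hX : Tight k g B X) (hY : Tight k g B Y)
    (hXY : (X ∩ Y).Nonempty) : Tight k g B (X ∪ Y) ∧ Tight k g B (X ∩ Y) := by
  have hu : (X ∪ Y).Nonempty := hX.1.mono subset_union_left
  have hsup := card_inside_add_card_inside_le (g := g) (B := B) (X := X) (Y := Y)
  have hcard := mul_card_union_add_mul_card_inter k X Y
  have hsparse_union := hB _ hu
  have hsparse_inter := hB _ hXY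
  have hX_eq := hX.2
  have hY_eq := hY.2
  exact ⟨⟨hu, by omega⟩, ⟨hXY, by omega⟩⟩

lemma exists_least_tight (hB : Sparse k g B) {P : Finset α} (hP : P.Nonempty)
    (h : ∃ X, Tight k g B X ∧ P ⊆ X) :
    ∃ Q, Tight k g B Q ∧ P ⊆ Q ∧ ∀ X, Tight k g B X → P ⊆ X → Q ⊆ X := by
  obtain ⟨Q, ⟨hQ, hPQ⟩, hmin⟩ :=
    exists_minimal_of_wellFoundedLT (fun X => Tight k g B X ∧ P ⊆ X) h
  refine ⟨Q, hQ, hPQ, fun X hX hPX => ?_⟩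
  have hPQX := subset_inter hPQ hPX
  exact (hmin ⟨(hQ.union_inter hB hX (hP.mono hPQX)).2, hPQX⟩ inter_subset_left).trans
    inter_subset_right

lemma Sparse.exchange [DecidableEq β] (hB : Sparse k g B) {e b : β}
    (hQ : ∀ X, Tight k g B X → g e ⊆ X → b ∈ inside g B X) :
    Sparse k g (insert e (B.erase b)) := by
  refine (hB.mono (erase_subset b B)).insert_of_not_tight fun X hX heX => ?_
  have hBX := hB X hX.1
  have hX_eq := hX.2
  have hle := card_le_card (inside_mono (g := g) (erase_subset b B) (subset_refl X))
  have hbX := hQ X ⟨hX.1, by omega⟩ heX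
  have hpos := card_pos.2 ⟨b, hbX⟩
  rw [inside_erase, card_erase_of_mem hbX] at hX_eq
  omega

lemma Tight.exists_mem (hk : k ≠ 0) (hB : Sparse k g B) (hX : Tight k g B X)
    (hXnt : X.Nontrivial) {z : α} (hz : z ∈ X) : ∃ b ∈ inside g B X, z ∈ g b := by
  by_contra! hcon
  have hsub : inside g B X ⊆ inside g B (X.erase z) := fun b hb =>
    mem_inside.2 ⟨(mem_inside.1 hb).1, subset_erase.2 ⟨(mem_inside.1 hb).2, hcon b hb⟩⟩
  have hle := card_le_card hsub
  have hsparse := hB _ (hXnt.erase_nonempty (a := z))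
  rw [card_erase_of_mem hz, Nat.mul_sub_one] at hsparse
  have hX_eq := hX.2
  omega

lemma Sparse.exists_deg_lt (hk : k ≠ 0) (hB : Sparse k g B) (hBV : IsMultigraph g B V)
    (hV : V.Nonempty) : ∃ v ∈ V, deg g B v < 2 * k := by
  refine exists_lt_of_sum_lt (s := V) (g := fun _ => 2 * k) ?_
  have hsparse := hB V hV
  rw [inside_eq_self fun e he => (hBV e he).1] at hsparse
  rw [sum_deg hBV, sum_const, smul_eq_mul, mul_left_comm, mul_comm (#V) k]
  omega

end SparseSets

/-! ### Decomposition into two forests -/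

section Forests

variable [DecidableEq α]

lemma inside_congr {g' : β → Finset α} (h : ∀ e ∈ B, g e = g' e) :
    inside g B X = inside g' B X :=
  filter_congr fun e he => by rw [h e he]

lemma sparse_congr {g' : β → Finset α} (h : ∀ e ∈ B, g e = g' e) :
    Sparse k g B ↔ Sparse k g' B := by
  simp only [Sparse, inside_congr h]

lemma tight_congr {g' : β → Finset α} (h : ∀ e ∈ B, g e = g' e) :
    Tight k g B X ↔ Tight k g' B X := by
  simp only [Tight, inside_congr h]

/-- Subdividing the edge `p = uw` of a forest at the new vertex `v`: now `p` joins `v` to `u`, and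
the new edge `q` joins `v` to `w`. -/
lemma Sparse.subdivide [DecidableEq β] {T : Finset β} {p q : β} {v u w : α}
    (hT : Sparse 1 (update g p {u, w}) (insert p T)) (hpT : p ∉ T)
    (hv : ∀ e ∈ T, v ∉ g e) (hp : g p = {v, u}) (hq : g q = {v, w}) (hu : u ≠ v) (hw : w ≠ v) :
    Sparse 1 g (insert p (insert q T)) := by
  have hTg : Sparse 1 g T :=
    (sparse_congr (update_eq_of_mem hpT)).1 (hT.mono (subset_insert p T))
  have hqT : Sparse 1 g (insert q T) := by
    rw [insert_eq]
    exact hTg.union_star hv (by simp [hq, card_pair hw.symm]) (by simp)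
  refine hqT.insert_of_not_tight fun X ⟨_, hX⟩ hpX => ?_
  obtain ⟨hvX, huX⟩ : v ∈ X ∧ u ∈ X := by simpa [hp, insert_subset_iff] using hpX
  have huXv : u ∈ X.erase v := mem_erase.2 ⟨hu, huX⟩
  have hcard := card_erase_add_one hvX
  have hTX := inside_erase_vertex (X := X) hv
  by_cases hwX : w ∈ X
  · have hsparse := hT (X.erase v) ⟨u, huXv⟩
    have hp_sub : update g p {u, w} p ⊆ X.erase v := by
      simp [insert_subset_iff, huX, hu, hwX, hw]
    have hq_sub : g q ⊆ X := by simp [hq, insert_subset_iff, hvX, hwX]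
    rw [inside_insert_of_subset hp_sub, inside_congr (update_eq_of_mem hpT), hTX,
      card_insert_of_notMem fun h => hpT (mem_inside.1 h).1] at hsparse
    rw [inside_insert_of_subset hq_sub] at hX
    have := card_insert_le q (inside g T X)
    omega
  · have hsparse := hTg (X.erase v) ⟨u, huXv⟩
    have hq_sub : ¬ g q ⊆ X := by simp [hq, insert_subset_iff, hwX]
    rw [inside_insert_of_not_subset hq_sub, ← hTX] at hX
    omega

/-- The edge set `B` is the disjoint union of the edge sets of two forests; a forest is a `1`-sparse
edge set. -/
def SplitsIntoForests [DecidableEq β] (g : β → Finset α) (B : Finset β) : Prop :=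
  ∃ T₁ T₂, T₁ ∪ T₂ = B ∧ Disjoint T₁ T₂ ∧ Sparse 1 g T₁ ∧ Sparse 1 g T₂

namespace SplitsIntoForests

variable [DecidableEq β] {B₀ : Finset β} {v : α}

lemma union_star {D : Finset β} (hB : SplitsIntoForests g B₀) (hv : ∀ e ∈ B₀, v ∉ g e)
    (hD : ∀ e ∈ D, v ∈ g e ∧ #(g e) = 2) (hD2 : #D ≤ 2) : SplitsIntoForests g (D ∪ B₀) := by
  obtain ⟨T₁, T₂, rfl, hdisj, hT₁, hT₂⟩ := hB
  obtain ⟨D₁, hD₁, hcard⟩ := exists_subset_card_eq (Nat.div_le_self #D 2)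
  have hcard_sdiff := card_sdiff_of_subset hD₁
  refine ⟨D₁ ∪ T₁, D \ D₁ ∪ T₂, by grind, ?_, ?_, ?_⟩
  · rw [disjoint_left] at hdisj ⊢
    grind
  · exact hT₁.union_star (v := v) (by grind) (by grind) (by omega)
  · exact hT₂.union_star (v := v) (by grind) (by grind) (by omega)

/-- The inductive step at a vertex `v` of degree three with edges `p = vu`, `q = vw` and `r`: in a
decomposition of the smaller graph with a new edge `uw`, that edge is subdivided by `v`, and `r` is
hung on the other forest. -/
lemma of_update {p q r : β} {u w : α}
    (h : SplitsIntoForests (update g p {u, w}) (insert p B₀)) (hv : ∀ e ∈ B₀, v ∉ g e)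
    (hp : g p = {v, u}) (hq : g q = {v, w}) (hu : u ≠ v) (hw : w ≠ v)
    (hr : v ∈ g r) (hr2 : #(g r) = 2) (hpq : p ≠ q) (hpr : p ≠ r) (hqr : q ≠ r) :
    SplitsIntoForests g (insert p (insert q (insert r B₀))) := by
  obtain ⟨T₁, T₂, hunion, hdisj, hT₁, hT₂⟩ := h
  have hmem : ∀ e, e ∈ T₁ ∨ e ∈ T₂ ↔ e = p ∨ e ∈ B₀ := fun e => by
    rw [← mem_union, hunion, mem_insert]
  wlog hpT : p ∈ T₁ generalizing T₁ T₂
  · have hpT₂ : p ∈ T₂ := by grind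
    exact this T₂ T₁ (by rw [union_comm, hunion]) hdisj.symm hT₂ hT₁ (by grind) hpT₂
  have hpT₂ : p ∉ T₂ := disjoint_left.1 hdisj hpT
  have hT₁B : T₁.erase p ⊆ B₀ := by grind
  have hT₂B : T₂ ⊆ B₀ := by grind
  refine ⟨insert p (insert q (T₁.erase p)), insert r T₂, by grind, ?_, ?_, ?_⟩
  · have hqB : q ∉ B₀ := fun h => hv q h (by simp [hq])
    have hrB : r ∉ B₀ := fun h => hv r h hr
    rw [disjoint_left] at hdisj ⊢
    grind
  · refine Sparse.subdivide (v := v) ?_ (notMem_erase p T₁) (fun e he => hv e (hT₁B he))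
      hp hq hu hw
    rwa [insert_erase hpT]
  · have hT₂g := (sparse_congr (update_eq_of_mem hpT₂)).1 hT₂
    rw [insert_eq]
    exact hT₂g.union_star (fun e he => hv e (hT₂B he)) (by simp [hr, hr2]) (by simp)

end SplitsIntoForests

lemma IsMultigraph.exists_eq_pair (hB : IsMultigraph g B V) {e : β} (he : e ∈ B) {v : α}
    (hv : v ∈ g e) : ∃ u ∈ V.erase v, g e = {v, u} := by
  obtain ⟨u, hu⟩ := card_eq_one.1 ((card_erase_of_mem hv).trans (by rw [(hB e he).2]))
  have hu' : u ∈ (g e).erase v := hu ▸ mem_singleton_self u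
  exact ⟨u, mem_erase.2 ⟨ne_of_mem_erase hu', (hB e he).1 (mem_of_mem_erase hu')⟩,
    by rw [← insert_erase hv, hu]⟩

/-- Among the three edges at `v`, two can be replaced by a new edge between their other ends: tight
sets that forbid this for two of the pairs would have a tight union, which together with `v` spans
too many edges. -/
lemma Sparse.exists_pair_not_tight [DecidableEq β] {v : α} (hB : Sparse 2 g B)
    (hBV : IsMultigraph g B V) (hdeg : deg g B v = 3) :
    ∃ p q r u w, {e ∈ B | v ∈ g e} = {p, q, r} ∧ p ≠ q ∧ p ≠ r ∧ q ≠ r ∧ g p = {v, u} ∧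
      g q = {v, w} ∧ u ∈ V.erase v ∧ w ∈ V.erase v ∧
      ∀ X, Tight 2 g {e ∈ B | v ∉ g e} X → ¬ {u, w} ⊆ X := by
  obtain ⟨a, b, c, hab, hac, hbc, habc⟩ := card_eq_three.1 hdeg
  have hother : ∀ e ∈ ({a, b, c} : Finset β), ∃ u ∈ V.erase v, g e = {v, u} := fun e he =>
    have ⟨heB, hve⟩ := mem_filter.1 (habc ▸ he)
    hBV.exists_eq_pair heB hve
  obtain ⟨x, hxV, hx⟩ := hother a (by simp)
  obtain ⟨y, hyV, hy⟩ := hother b (by simp)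
  obtain ⟨z, hzV, hz⟩ := hother c (by simp)
  set B₀ := {e ∈ B | v ∉ g e}
  by_contra! hcon
  obtain ⟨P, hP, hxyP⟩ := hcon a b c x y habc hab hac hbc hx hy hxV hyV
  obtain ⟨Q, hQ, hxzQ⟩ := hcon a c b x z (habc.trans (by rw [pair_comm])) hac hab hbc.symm
    hx hz hxV hzV
  simp only [insert_subset_iff, singleton_subset_iff] at hxyP hxzQ
  have hB₀sparse : Sparse 2 g B₀ := hB.mono (filter_subset _ _)
  obtain ⟨⟨-, hPQ⟩, -⟩ := hP.union_inter hB₀sparse hQ ⟨x, mem_inter.2 ⟨hxyP.1, hxzQ.1⟩⟩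
  have hvPQ : v ∉ P ∪ Q := by
    have hnot {X : Finset α} (hX : Tight 2 g B₀ X) (hxX : x ∈ X) : v ∉ X := fun hvX => by
      obtain ⟨e, he, hve⟩ := hX.exists_mem two_ne_zero hB₀sparse
        ⟨x, hxX, v, hvX, ne_of_mem_erase hxV⟩ hvX
      exact (mem_filter.1 (mem_inside.1 he).1).2 hve
    simp [hnot hP hxyP.1, hnot hQ hxzQ.1]
  have hsub : {a, b, c} ∪ inside g B₀ (P ∪ Q) ⊆ inside g B (insert v (P ∪ Q)) := by
    refine union_subset (fun e he => mem_inside.2 ⟨?_, ?_⟩)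
      (inside_mono (filter_subset _ _) (subset_insert _ _))
    · exact (mem_filter.1 (habc ▸ he)).1
    · simp only [mem_insert, mem_singleton] at he
      rcases he with rfl | rfl | rfl <;> simp [*, insert_subset_iff]
  have hdisj : Disjoint {a, b, c} (inside g B₀ (P ∪ Q)) := by
    rw [← habc]
    exact (disjoint_filter_filter_not B B _).mono_right (filter_subset _ _)
  have hle := card_le_card hsub
  have hsparse := hB _ (insert_nonempty v (P ∪ Q))
  rw [card_union_of_disjoint hdisj, card_eq_three.2 ⟨a, b, c, hab, hac, hbc, rfl⟩] at hle
  rw [card_insert_of_notMem hvPQ] at hsparse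
  omega

/-- The Nash-Williams theorem for two forests, by Henneberg reductions at a vertex of degree at most
three. -/
theorem Sparse.splitsIntoForests [DecidableEq β] (hBV : IsMultigraph g B V) (hB : Sparse 2 g B) :
    SplitsIntoForests g B := by
  induction hn : #V generalizing V g B with
  | zero =>
    obtain rfl : B = ∅ := eq_empty_of_forall_notMem fun e he => by
      have := card_le_card (hBV e he).1
      have := (hBV e he).2
      omega
    exact ⟨∅, ∅, rfl, disjoint_empty_left _, sparse_empty, sparse_empty⟩
  | succ n ih =>
    obtain ⟨v, hvV, hdeg⟩ := hB.exists_deg_lt two_ne_zero hBV (card_pos.1 (by omega))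
    have hcard : #(V.erase v) = n := by rw [card_erase_of_mem hvV, hn, Nat.add_sub_cancel]
    set B₀ := {e ∈ B | v ∉ g e}
    have hv : ∀ e ∈ B₀, v ∉ g e := fun e he => (mem_filter.1 he).2
    have hB₀V : IsMultigraph g B₀ (V.erase v) := fun e he =>
      ⟨subset_erase.2 ⟨(hBV e (mem_filter.1 he).1).1, hv e he⟩, (hBV e (mem_filter.1 he).1).2⟩
    have hB₀sparse : Sparse 2 g B₀ := hB.mono (filter_subset _ _)
    have hstar : ∀ e ∈ B.filter (v ∈ g ·), v ∈ g e ∧ #(g e) = 2 := fun e he =>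
      ⟨(mem_filter.1 he).2, (hBV e (mem_filter.1 he).1).2⟩
    have hsplit : B.filter (v ∈ g ·) ∪ B₀ = B := filter_union_filter_not_eq _ _
    rw [← hsplit]
    rcases (show deg g B v ≤ 2 ∨ deg g B v = 3 by omega) with hdeg | hdeg
    · exact (ih hB₀V hB₀sparse hcard).union_star hv hstar hdeg
    obtain ⟨p, q, r, u, w, hpqr, hpq, hpr, hqr, hp, hq, hu, hw, hnot⟩ :=
      hB.exists_pair_not_tight hBV hdeg
    rw [hpqr] at hstar ⊢
    have hcongr := update_eq_of_mem (g := g) (s := {u, w}) fun h => hv p h (hstar p (by simp)).1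
    have huw : u ≠ w := by
      rintro rfl
      exact hnot _ (tight_singleton (fun e he => (hB₀V e he).2) u) (by simp)
    have hsparse : Sparse 2 (update g p {u, w}) (insert p B₀) :=
      ((sparse_congr hcongr).2 hB₀sparse).insert_of_not_tight fun X hX hX' =>
        hnot X ((tight_congr hcongr).1 hX) (by rwa [update_self] at hX')
    have hgraph : IsMultigraph (update g p {u, w}) (insert p B₀) (V.erase v) := fun e he => by
      rcases mem_insert.1 he with rfl | he
      · rw [update_self]
        exact ⟨insert_subset hu (singleton_subset_iff.2 hw), card_pair huw⟩
      · rw [hcongr e he]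
        exact hB₀V e he
    have := (ih hgraph hsparse hcard).of_update hv hp hq (ne_of_mem_erase hu) (ne_of_mem_erase hw)
      (hstar r (by simp)).1 (hstar r (by simp)).2 hpq hpr hqr
    simpa only [insert_union, singleton_union] using this

end Forests

/-! ### Bases and local exchanges -/

section Bases

variable {B₁ B₂ : Finset β} {W : Finset α}

/-- `B` and `B'` contain the same edges among those that do not lie inside `X`. -/
def AgreeOff (g : β → Finset α) (B B' : Finset β) (X : Finset α) : Prop :=
  ∀ e, ¬ g e ⊆ X → (e ∈ B ↔ e ∈ B')

namespace AgreeOff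

lemma trans (h : AgreeOff g B B₁ X) (h' : AgreeOff g B₁ B' X) : AgreeOff g B B' X :=
  fun e he => (h e he).trans (h' e he)

lemma mono (h : AgreeOff g B B' X) (hXY : X ⊆ Y) : AgreeOff g B B' Y :=
  fun e he => h e fun heX => he (heX.trans hXY)

end AgreeOff

variable [DecidableEq α]

namespace AgreeOff

lemma deg_eq (h : AgreeOff g B B' X) {v : α} (hv : v ∉ X) : deg g B v = deg g B' v := by
  unfold deg
  congr 1
  ext e
  simp only [mem_filter]
  exact and_congr_left fun hve => h e fun heX => hv (heX hve)

lemma card_inside_iff (h : AgreeOff g B B' X) (hXZ : X ⊆ Z) :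
    #(inside g B X) = #(inside g B' X) ↔ #(inside g B Z) = #(inside g B' Z) := by
  have hoff : {e ∈ B | g e ⊆ Z ∧ ¬ g e ⊆ X} = {e ∈ B' | g e ⊆ Z ∧ ¬ g e ⊆ X} := by
    ext e
    simp only [mem_filter]
    exact and_congr_left fun he => h e he.2
  rw [card_inside_eq_add (B := B) hXZ, card_inside_eq_add (B := B') hXZ, hoff,
    Nat.add_right_cancel_iff]

lemma inside_eq_of_disjoint (h : AgreeOff g B B' X) (hB : IsMultigraph g B V)
    (hB' : IsMultigraph g B' V) (hXY : Disjoint X Y) : inside g B Y = inside g B' Y := by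
  have hnot {e : β} (he : #(g e) = 2) (heY : g e ⊆ Y) : ¬ g e ⊆ X := fun heX => by
    have hempty : g e = ∅ := disjoint_self.1 (hXY.mono heX heY)
    simp [hempty] at he
  ext e
  simp only [mem_inside]
  exact ⟨fun he => ⟨(h e (hnot (hB e he.1).2 he.2)).1 he.1, he.2⟩,
    fun he => ⟨(h e (hnot (hB' e he.1).2 he.2)).2 he.1, he.2⟩⟩

end AgreeOff

/-- `B` is a basis of the `k`-sparsity matroid of the multigraph `(V, E)`, in the case where the
bases have `k (|V| - 1)` edges. -/
structure IsBase (k : ℕ) (g : β → Finset α) (E : Finset β) (V : Finset α) (B : Finset β) :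
    Prop where
  subset : B ⊆ E
  sparse : Sparse k g B
  tight : Tight k g B V

/-- `B'` is a base that arises from `B` by changing only edges inside the tight set `X`. -/
structure IsRebase (k : ℕ) (g : β → Finset α) (E : Finset β) (V : Finset α) (B B' : Finset β)
    (X : Finset α) : Prop where
  base : IsBase k g E V B'
  subset : X ⊆ V
  tight : Tight k g B X
  agreeOff : AgreeOff g B B' X

lemma IsBase.card_add (hE : IsMultigraph g E V) (hB : IsBase k g E V B) : #B + k = k * #V := by
  simpa [inside_eq_self fun e he => (hE e (hB.subset he)).1] using hB.tight.2

lemma IsBase.tight_iff (hB : IsBase k g E V B) (hB' : IsBase k g E V B')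
    (h : AgreeOff g B B' X) (hXV : X ⊆ V) (hXZ : X ⊆ Z) : Tight k g B Z ↔ Tight k g B' Z := by
  have hV : #(inside g B V) = #(inside g B' V) :=
    Nat.add_right_cancel (hB.tight.2.trans hB'.tight.2.symm)
  rw [Tight, Tight, (h.card_inside_iff hXZ).1 ((h.card_inside_iff hXV).2 hV)]

section Replace

variable [DecidableEq β]

/-- The edge set obtained from `B` by replacing its edges inside `X` by those of `B'`. -/
def replace (g : β → Finset α) (B B' : Finset β) (X : Finset α) : Finset β :=
  {e ∈ B | ¬ g e ⊆ X} ∪ inside g B' X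

lemma mem_replace {e : β} :
    e ∈ replace g B B' X ↔ (e ∈ B ∧ ¬ g e ⊆ X) ∨ (e ∈ B' ∧ g e ⊆ X) := by
  rw [replace, mem_union, mem_filter, mem_inside]

lemma inside_replace : inside g (replace g B B' X) X = inside g B' X := by
  ext e
  simp only [mem_inside, mem_replace]
  tauto

lemma agreeOff_replace : AgreeOff g B (replace g B B' X) X := fun e he => by
  rw [mem_replace]
  tauto

lemma card_inside_replace : #(inside g (replace g B B' X) Z)
    = #(inside g B' (X ∩ Z)) + #{e ∈ B | g e ⊆ Z ∧ ¬ g e ⊆ X ∩ Z} := by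
  rw [card_inside_eq_add (inter_subset_right : X ∩ Z ⊆ Z)]
  congr 2 <;>
  · ext e
    simp only [mem_inside, mem_filter, mem_replace, subset_inter_iff]
    tauto

lemma Sparse.replace (hB : Sparse k g B) (hB' : Sparse k g B') (hX : Tight k g B X)
    (hB'2 : ∀ e ∈ B', #(g e) = 2) : Sparse k g (replace g B B' X) := by
  intro Z hZ
  have hreplace := card_inside_replace (g := g) (B := B) (B' := B') (X := X) (Z := Z)
  have hsplit := card_inside_eq_add (g := g) (B := B) (inter_subset_right : X ∩ Z ⊆ Z)
  rcases (X ∩ Z).eq_empty_or_nonempty with hXZ | hXZ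
  · have hB'XZ : inside g B' (X ∩ Z) = ∅ := inside_eq_empty_of_card_le_one hB'2 (by simp [hXZ])
    have hBZ := hB Z hZ
    rw [hB'XZ, card_empty] at hreplace
    omega
  · have hsup := card_inside_add_card_inside_le (g := g) (B := B) (X := X) (Y := Z)
    have hcard := mul_card_union_add_mul_card_inter k X Z
    have hunion := hB _ (hX.1.mono (subset_union_left : X ⊆ X ∪ Z))
    have hinter := hB' _ hXZ
    have hX_eq := hX.2
    omega

lemma IsBase.replace (hE : IsMultigraph g E V) (hB : IsBase k g E V B) (hB' : IsBase k g E V B')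
    (hXV : X ⊆ V) (hX : Tight k g B X) (hX' : Tight k g B' X) :
    IsBase k g E V (replace g B B' X) where
  subset e he := (mem_replace.1 he).elim (fun h => hB.subset h.1) fun h => hB'.subset h.1
  sparse := hB.sparse.replace hB'.sparse hX fun e he => (hE e (hB'.subset he)).2
  tight := by
    have hcard : #(inside g B X) = #(inside g (TreeConnectivity.replace g B B' X) X) := by
      rw [inside_replace]
      exact Nat.add_right_cancel (hX.2.trans hX'.2.symm)
    exact ⟨hB.tight.1, (agreeOff_replace.card_inside_iff hXV).1 hcard ▸ hB.tight.2⟩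

end Replace

lemma IsRebase.exists_glue (hE : IsMultigraph g E V) (hB : IsBase k g E V B)
    (h₁ : IsRebase k g E V B B₁ X) (h₂ : IsRebase k g E V B B₂ Y) (hXY : Disjoint X Y) :
    ∃ B', IsBase k g E V B' ∧ AgreeOff g B₁ B' Y ∧ AgreeOff g B₂ B' X ∧
      Tight k g B' X ∧ Tight k g B' Y := by
  classical
  have hmulti {C : Finset β} (hC : IsBase k g E V C) : IsMultigraph g C V := hE.mono hC.subset
  have tight_of_disjoint {C C' : Finset β} {P Q : Finset α} (hC : IsBase k g E V C)
      (hC' : IsBase k g E V C') (h : AgreeOff g C C' P) (hPQ : Disjoint P Q)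
      (hQ : Tight k g C Q) : Tight k g C' Q := by
    rwa [Tight, ← h.inside_eq_of_disjoint (hmulti hC) (hmulti hC') hPQ]
  have hY₁ : Tight k g B₁ Y := tight_of_disjoint hB h₁.base h₁.agreeOff hXY h₂.tight
  have hY₂ : Tight k g B₂ Y :=
    (hB.tight_iff h₂.base h₂.agreeOff h₂.subset subset_rfl).1 h₂.tight
  have hX₁ : Tight k g B₁ X :=
    (hB.tight_iff h₁.base h₁.agreeOff h₁.subset subset_rfl).1 h₁.tight
  have hB' := h₁.base.replace hE h₂.base h₂.subset hY₁ hY₂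
  refine ⟨replace g B₁ B₂ Y, hB', agreeOff_replace, fun e heX => ?_,
    tight_of_disjoint h₁.base hB' agreeOff_replace hXY.symm hX₁,
    (h₁.base.tight_iff hB' agreeOff_replace h₂.subset subset_rfl).1 hY₁⟩
  have hBB₁ := h₁.agreeOff e heX
  have hBB₂ := h₂.agreeOff e
  rw [mem_replace]
  tauto

lemma IsBase.exists_exchange [DecidableEq β] (hk : k ≠ 0) (hE : IsMultigraph g E V)
    (hB : IsBase k g E V B) {e : β} (he : e ∈ E) (heB : e ∉ B) {M : Finset α} (hMV : M ⊆ V)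
    (hM : Tight k g B M) (heM : g e ⊆ M)
    (hW : ∀ X ⊆ V, Tight k g B X → g e ⊆ X → ¬ Disjoint X W) :
    ∃ b ∈ B, ∃ z ∈ M ∩ W, z ∈ g b ∧ IsRebase k g E V B (insert e (B.erase b)) M := by
  obtain ⟨Q, hQ, heQ, hQmin⟩ := exists_least_tight hB.sparse
    (card_pos.1 (by rw [(hE e he).2]; exact two_pos) : (g e).Nonempty) ⟨M, hM, heM⟩
  have hQM : Q ⊆ M := hQmin M hM heM
  obtain ⟨z, hzQ, hzW⟩ := not_disjoint_iff.1 (hW Q (hQM.trans hMV) hQ heQ)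
  have hQnt : Q.Nontrivial := one_lt_card_iff_nontrivial.1
    (one_lt_two.trans_le ((hE e he).2 ▸ card_le_card heQ))
  obtain ⟨b, hbQ, hzb⟩ := hQ.exists_mem hk hB.sparse hQnt hzQ
  have hb := mem_inside.1 hbQ
  have hsubset : insert e (B.erase b) ⊆ E :=
    insert_subset he ((erase_subset _ _).trans hB.subset)
  refine ⟨b, hb.1, z, mem_inter.2 ⟨hQM hzQ, hzW⟩, hzb, ⟨hsubset, ?_, hB.tight.1, ?_⟩, hMV, hM,
    fun c hc => ?_⟩
  · exact hB.sparse.exchange fun X hX heX => mem_inside.2 ⟨hb.1, hb.2.trans (hQmin X hX heX)⟩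
  · rw [inside_eq_self fun c hc => (hE c (hsubset hc)).1,
      card_insert_of_notMem (mt mem_of_mem_erase heB), card_erase_add_one hb.1]
    exact hB.card_add hE
  · have hce : c ≠ e := fun h => hc (h ▸ heM)
    have hcb : c ≠ b := fun h => hc (h ▸ hb.2.trans hQM)
    simp [hce, hcb]

end Bases

/-! ### Bases of bounded degree -/

section BoundedDegree

variable [DecidableEq α] {W : Finset α} {h : α → ℕ} {n : ℕ}

/-- The degree of `u` can be pushed below `h u` by changing `B` inside a tight set that avoids `W`,
while the degrees outside `W` stay within `h`. -/
def Fixable (k : ℕ) (g : β → Finset α) (E : Finset β) (V : Finset α) (h : α → ℕ) (B : Finset β)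
    (W : Finset α) (u : α) : Prop :=
  ∃ B' X, IsRebase k g E V B B' X ∧ u ∈ X ∧ Disjoint X W ∧
    (∀ v ∈ V, v ∉ W → deg g B' v ≤ h v) ∧ deg g B' u < h u

lemma Fixable.notMem {u : α} (hu : Fixable k g E V h B W u) : u ∉ W := by
  obtain ⟨-, X, -, huX, hXW, -⟩ := hu
  exact disjoint_left.1 hXW huX

/-- If no tight set avoiding `W` spans `e = xy`, then the tight sets used to fix `x` and `y` are
disjoint, so both changes can be made at once. -/
lemma Fixable.exists_common_base (hE : IsMultigraph g E V) (hB : IsBase k g E V B) {e : β}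
    {x y : α} (hexy : g e = {x, y}) (hx : Fixable k g E V h B W x) (hy : Fixable k g E V h B W y)
    (hsep : ∀ X ⊆ V, Tight k g B X → g e ⊆ X → ¬ Disjoint X W) :
    ∃ C X, IsBase k g E V C ∧ X ⊆ V ∧ Disjoint X W ∧ AgreeOff g B C X ∧ (e ∈ C → e ∈ B) ∧
      (∀ Z, g e ⊆ Z → Tight k g B Z ∨ Tight k g C Z → Tight k g B (Z ∪ X)) ∧
      (∀ v ∈ V, v ∉ W → deg g C v ≤ h v) ∧ ∀ v ∈ g e, deg g C v < h v := by
  obtain ⟨B₁, X, h₁, hxX, hXW, hdeg₁, hxdeg⟩ := hx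
  obtain ⟨B₂, Y, h₂, hyY, hYW, hdeg₂, hydeg⟩ := hy
  have hXYV : X ∪ Y ⊆ V := union_subset h₁.subset h₂.subset
  have hXYW : Disjoint (X ∪ Y) W := disjoint_union_left.2 ⟨hXW, hYW⟩
  have hXY : Disjoint X Y := by
    by_contra hmeet
    refine hsep _ hXYV
      (h₁.tight.union_inter hB.sparse h₂.tight (not_disjoint_iff_nonempty_inter.1 hmeet)).1 ?_ hXYW
    simp [hexy, insert_subset_iff, hxX, hyY]
  have hyX : y ∉ X := disjoint_right.1 hXY hyY
  have hxY : x ∉ Y := disjoint_left.1 hXY hxX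
  have hxe : x ∈ g e := by simp [hexy]
  have hye : y ∈ g e := by simp [hexy]
  obtain ⟨C, hC, hB₁C, hB₂C, hCX, hCY⟩ := h₁.exists_glue hE hB h₂ hXY
  have hBC : AgreeOff g B C (X ∪ Y) :=
    (h₁.agreeOff.mono subset_union_left).trans (hB₁C.mono subset_union_right)
  have hgrow {D : Finset β} (hD : Sparse k g D) (hDX : Tight k g D X) (hDY : Tight k g D Y)
      {Z : Finset α} (heZ : g e ⊆ Z) (hZ : Tight k g D Z) : Tight k g D (Z ∪ (X ∪ Y)) := by
    have hZX := (hZ.union_inter hD hDX ⟨x, mem_inter.2 ⟨heZ hxe, hxX⟩⟩).1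
    have hy_mem : y ∈ (Z ∪ X) ∩ Y := mem_inter.2 ⟨mem_union_left _ (heZ hye), hyY⟩
    exact union_assoc Z X Y ▸ (hZX.union_inter hD hDY ⟨y, hy_mem⟩).1
  refine ⟨C, X ∪ Y, hC, hXYV, hXYW, hBC, fun heC => ?_, fun Z heZ hZ => ?_,
    fun v hvV hvW => ?_, ?_⟩
  · exact (h₁.agreeOff e fun heX => hyX (heX hye)).2 ((hB₁C e fun heY => hxY (heY hxe)).2 heC)
  · rcases hZ with hZ | hZ
    · exact hgrow hB.sparse h₁.tight h₂.tight heZ hZ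
    · exact (hB.tight_iff hC hBC hXYV subset_union_right).2 (hgrow hC.sparse hCX hCY heZ hZ)
  · by_cases hvY : v ∈ Y
    · exact hB₂C.deg_eq (disjoint_right.1 hXY hvY) ▸ hdeg₂ v hvV hvW
    · exact hB₁C.deg_eq hvY ▸ hdeg₁ v hvV hvW
  · rw [hexy]
    intro v hv
    rcases mem_insert.1 hv with rfl | hv
    · exact hB₁C.deg_eq hxY ▸ hxdeg
    · rw [mem_singleton.1 hv]
      exact hB₂C.deg_eq hyX ▸ hydeg

/-- Once the degrees at both ends of `e` are small, there is room for `e`, which can be exchanged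
for an edge at a vertex of `W`. -/
lemma Fixable.exists_exchange (hk : k ≠ 0) (hE : IsMultigraph g E V) (hB : IsBase k g E V B)
    {e : β} (he : e ∈ E) (heB : e ∉ B) (hfix : ∀ v ∈ g e, Fixable k g E V h B W v)
    {M : Finset α} (hMV : M ⊆ V) (hM : Tight k g B M) (heM : g e ⊆ M)
    (hsep : ∀ X ⊆ V, Tight k g B X → g e ⊆ X → ¬ Disjoint X W) :
    ∃ B' M', IsRebase k g E V B B' M' ∧ M' ∩ W ⊆ M ∧ (∀ v ∈ V, v ∉ W → deg g B' v ≤ h v) ∧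
      (∀ v ∈ W, deg g B' v ≤ deg g B v) ∧ ∃ z ∈ M' ∩ W, deg g B' z < deg g B z := by
  classical
  obtain ⟨x, y, -, hexy⟩ := card_eq_two.1 (hE e he).2
  obtain ⟨C, X, hC, hXV, hXW, hBC, heCB, hgrow, hdeg, hdege⟩ :=
    (hfix x (by simp [hexy])).exists_common_base hE hB hexy (hfix y (by simp [hexy])) hsep
  have htight {Z : Finset α} (hZ : X ⊆ Z) : Tight k g B Z ↔ Tight k g C Z :=
    hB.tight_iff hC hBC hXV hZ
  have hMX : Tight k g B (M ∪ X) := hgrow M heM (.inl hM)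
  have hMXV : M ∪ X ⊆ V := union_subset hMV hXV
  obtain ⟨b, hb, z, hz, hzb, hrebase⟩ := hC.exists_exchange hk hE he (mt heCB heB) hMXV
    ((htight subset_union_right).1 hMX) (heM.trans subset_union_left) fun Z hZV hZ heZ hZW =>
      hsep (Z ∪ X) (union_subset hZV hXV) (hgrow Z heZ (.inr hZ)) (heZ.trans subset_union_left)
        (disjoint_union_left.2 ⟨hZW, hXW⟩)
  have hexch := deg_exchange (g := g) (mt heCB heB) hb
  have hW : ∀ v ∈ W, v ∉ g e ∧ deg g C v = deg g B v := fun v hv =>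
    ⟨fun hve => (hfix v hve).notMem hv, (hBC.deg_eq (disjoint_right.1 hXW hv)).symm⟩
  refine ⟨_, M ∪ X, ⟨hrebase.base, hMXV, hMX, (hBC.mono subset_union_right).trans
    hrebase.agreeOff⟩, fun v hv => ?_, fun v hvV hvW => ?_, fun v hv => ?_, z, hz, ?_⟩
  · obtain ⟨hv, hvW⟩ := mem_inter.1 hv
    exact (mem_union.1 hv).resolve_right (disjoint_right.1 hXW hvW)
  · have := hexch v
    have := hdeg v hvV hvW
    have := hdege v
    grind
  · have hve := hexch v
    rw [if_neg (hW v hv).1, (hW v hv).2] at hve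
    omega
  · have hzW := hW z (mem_inter.1 hz).2
    have hze := hexch z
    rw [if_neg hzW.1, if_pos hzb, hzW.2] at hze
    omega

open Classical in
/-- The increasing sequence of vertex sets that starts with the vertices of too large degree and
collects the vertices that cannot be fixed without changing the previous set. -/
noncomputable def rigid (k : ℕ) (g : β → Finset α) (E : Finset β) (V : Finset α) (h : α → ℕ)
    (B : Finset β) : ℕ → Finset α
  | 0 => {v ∈ V | h v < deg g B v}
  | n + 1 => {v ∈ V | ¬ Fixable k g E V h B (rigid k g E V h B n) v}

lemma mem_rigid_zero {v : α} : v ∈ rigid k g E V h B 0 ↔ v ∈ V ∧ h v < deg g B v := by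
  simp [rigid]

lemma mem_rigid_succ {v : α} : v ∈ rigid k g E V h B (n + 1) ↔
    v ∈ V ∧ ¬ Fixable k g E V h B (rigid k g E V h B n) v := by
  simp [rigid]

lemma rigid_subset : rigid k g E V h B n ⊆ V := by
  classical
  cases n <;> exact filter_subset _ _

lemma rigid_mono : Monotone (rigid k g E V h B) := monotone_nat_of_le_succ fun _ _ hv =>
  mem_rigid_succ.2 ⟨rigid_subset hv, fun hfix => hfix.notMem hv⟩

lemma exists_rigid_succ_eq : ∃ n, rigid k g E V h B (n + 1) = rigid k g E V h B n := by
  obtain ⟨n, hn⟩ := WellFoundedGT.monotone_chain_condition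
    (⟨fun m => (⟨rigid k g E V h B m, mem_powerset.2 rigid_subset⟩ : V.powerset),
      fun _ _ hab => rigid_mono hab⟩ : ℕ →o V.powerset)
  exact ⟨n, (congrArg Subtype.val (hn (n + 1) n.le_succ)).symm⟩

lemma fixable_of_notMem_rigid {v : α} (hvV : v ∈ V) (hv : v ∉ rigid k g E V h B (n + 1)) :
    Fixable k g E V h B (rigid k g E V h B n) v :=
  not_not.1 fun hfix => hv (mem_rigid_succ.2 ⟨hvV, hfix⟩)

lemma deg_le_of_notMem_rigid {v : α} (hvV : v ∈ V) (hv : v ∉ rigid k g E V h B n) :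
    deg g B v ≤ h v :=
  not_lt.1 fun hdeg => hv (rigid_mono n.zero_le (mem_rigid_zero.2 ⟨hvV, hdeg⟩))

lemma le_deg_of_mem_rigid (hE : IsMultigraph g E V) (hB : IsBase k g E V B) {v : α}
    (hv : v ∈ rigid k g E V h B n) : h v ≤ deg g B v := by
  induction n with
  | zero => exact (mem_rigid_zero.1 hv).2.le
  | succ n ih =>
    by_cases hvn : v ∈ rigid k g E V h B n
    · exact ih hvn
    obtain ⟨hvV, hfix⟩ := mem_rigid_succ.1 hv
    by_contra! hdeg
    have htight : Tight k g B {v} := tight_singleton (fun e he => (hE e (hB.subset he)).2) v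
    exact hfix ⟨B, {v}, ⟨hB, singleton_subset_iff.2 hvV, htight, fun _ _ => Iff.rfl⟩,
      mem_singleton_self v, disjoint_singleton_left.2 hvn,
      fun w hwV hw => deg_le_of_notMem_rigid hwV hw, hdeg⟩

/-- The total amount by which the degrees in `B` exceed the bounds `h`; vertices of small degree
contribute `0`, by truncated subtraction. -/
def excess (g : β → Finset α) (h : α → ℕ) (V : Finset α) (B : Finset β) : ℕ :=
  ∑ v ∈ V, (deg g B v - h v)

lemma exists_tight_of_notMem_rigid (hk : k ≠ 0) (hE : IsMultigraph g E V)
    (hB : IsBase k g E V B) (hmin : ∀ B', IsBase k g E V B' → excess g h V B ≤ excess g h V B')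
    {e : β} (he : e ∈ E) (heB : e ∉ B) (hen : Disjoint (g e) (rigid k g E V h B (n + 1))) :
    ∃ X ⊆ V, Tight k g B X ∧ g e ⊆ X ∧ Disjoint X (rigid k g E V h B n) := by
  have hfix : ∀ v ∈ g e, Fixable k g E V h B (rigid k g E V h B n) v := fun v hv =>
    fixable_of_notMem_rigid ((hE e he).1 hv) (disjoint_left.1 hen hv)
  induction n with
  | zero =>
    by_contra! hsep
    obtain ⟨B', M', hB', -, hle, hleW, z, hz, hdegz⟩ :=
      Fixable.exists_exchange hk hE hB he heB hfix subset_rfl hB.tight (hE e he).1 hsep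
    refine (hmin B' hB'.base).not_gt (sum_lt_sum (fun v hv => ?_)
      ⟨z, hB'.subset (mem_inter.1 hz).1, ?_⟩)
    · by_cases hvW : v ∈ rigid k g E V h B 0
      · exact Nat.sub_le_sub_right (hleW v hvW) _
      · rw [Nat.sub_eq_zero_of_le (hle v hv hvW)]
        exact Nat.zero_le _
    · have := (mem_rigid_zero.1 (mem_inter.1 hz).2).2
      omega
  | succ n ih =>
    have hen' : Disjoint (g e) (rigid k g E V h B (n + 1)) := hen.mono_right (rigid_mono (by omega))
    obtain ⟨M, hMV, hM, heM, hMW⟩ := ih hen' fun v hv =>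
      fixable_of_notMem_rigid ((hE e he).1 hv) (disjoint_left.1 hen' hv)
    by_contra! hsep
    obtain ⟨B', M', hB', hM'M, hle, hleW, z, hz, hdegz⟩ :=
      Fixable.exists_exchange hk hE hB he heB hfix hMV hM heM hsep
    obtain ⟨hzM', hzW⟩ := mem_inter.1 hz
    obtain ⟨hzV, hznot⟩ := mem_rigid_succ.1 hzW
    refine hznot ⟨B', M', hB', hzM', disjoint_left.2 fun v hv hvn => ?_, fun v hvV hvn => ?_,
      hdegz.trans_le (deg_le_of_notMem_rigid hzV (disjoint_left.1 hMW (hM'M hz)))⟩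
    · exact disjoint_left.1 hMW (hM'M (mem_inter.2 ⟨hv, rigid_mono n.le_succ hvn⟩)) hvn
    · by_cases hvW : v ∈ rigid k g E V h B (n + 1)
      · exact (hleW v hvW).trans (deg_le_of_notMem_rigid hvV hvn)
      · exact hle v hvV hvW

theorem exists_bounded_or_obstruction (hk : k ≠ 0) (hE : IsMultigraph g E V)
    (hex : ∃ B, IsBase k g E V B) (h : α → ℕ) :
    (∃ B, IsBase k g E V B ∧ ∀ v ∈ V, deg g B v ≤ h v) ∨
    ∃ B, IsBase k g E V B ∧ ∃ S ⊆ V, (∀ v ∈ S, h v ≤ deg g B v) ∧ (∃ v ∈ S, h v < deg g B v) ∧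
      ∀ e ∈ E, Disjoint (g e) S → e ∈ B ∨ ∃ X ⊆ V, Tight k g B X ∧ g e ⊆ X ∧ Disjoint X S := by
  obtain ⟨B, hB, hmin⟩ :=
    (measure (excess g h V)).wf.has_min {B | IsBase k g E V B} hex
  by_cases hgood : ∀ v ∈ V, deg g B v ≤ h v
  · exact .inl ⟨B, hB, hgood⟩
  push Not at hgood
  obtain ⟨v, hvV, hv⟩ := hgood
  obtain ⟨n, hn⟩ := exists_rigid_succ_eq (k := k) (g := g) (E := E) (V := V) (h := h) (B := B)
  refine .inr ⟨B, hB, rigid k g E V h B n, rigid_subset, fun v hv => le_deg_of_mem_rigid hE hB hv,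
    ⟨v, rigid_mono n.zero_le (mem_rigid_zero.2 ⟨hvV, hv⟩), hv⟩, fun e he hdisj => ?_⟩
  by_cases heB : e ∈ B
  · exact .inl heB
  · exact .inr (exists_tight_of_notMem_rigid hk hE hB (fun B' hB' => not_lt.1 (hmin B' hB')) he heB
      (hn ▸ hdisj))

end BoundedDegree

/-! ### Walks -/

section Walks

open Graph.Walk

variable {G : Graph α β} {x y z : α}

lemma length_support (p : G.Walk x y) : p.support.length = p.edges.length + 1 := by
  induction p with
  | nil => rfl
  | cons x e h p ih => simp [support, edges, ih]

lemma start_mem_support (p : G.Walk x y) : x ∈ p.support := by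
  cases p <;> simp [support]

lemma end_mem_support (p : G.Walk x y) : y ∈ p.support := by
  induction p with
  | nil => simp [support]
  | cons x _ _ p ih => simp [support, ih]

lemma mem_vertexSet_of_mem_support (p : G.Walk x y) : ∀ v ∈ p.support, v ∈ G.vertexSet := by
  induction p with
  | nil x hx => simpa [support] using hx
  | cons x e h p ih => exact List.forall_mem_cons.2 ⟨h.left_mem, ih⟩

lemma mem_edgeSet_of_mem_edges (p : G.Walk x y) : ∀ e ∈ p.edges, e ∈ G.edgeSet := by
  induction p with
  | nil => simp [edges]
  | cons x e h p ih => exact List.forall_mem_cons.2 ⟨h.edge_mem, ih⟩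

lemma mem_support_of_inc (p : G.Walk x y) : ∀ e ∈ p.edges, ∀ v, G.Inc e v → v ∈ p.support := by
  induction p with
  | nil => simp [edges]
  | cons x e h p ih =>
    refine List.forall_mem_cons.2 ⟨fun v hv => ?_, fun e' he' v hv => ?_⟩
    · rcases hv.eq_or_eq_of_isLink h with rfl | rfl
      · simp [support]
      · simp [support, start_mem_support p]
    · exact List.mem_cons_of_mem _ (ih e' he' v hv)

lemma exists_suffix (p : G.Walk x y) (hz : z ∈ p.support) :
    ∃ q : G.Walk z y, q.support <:+ p.support ∧ q.edges <:+ p.edges := by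
  induction p with
  | nil x hx =>
    obtain rfl := List.mem_singleton.1 hz
    exact ⟨nil z hx, List.suffix_rfl, List.suffix_rfl⟩
  | cons x e h p ih =>
    rcases List.mem_cons.1 hz with rfl | hz
    · exact ⟨cons z e h p, List.suffix_rfl, List.suffix_rfl⟩
    · obtain ⟨q, hsupport, hedges⟩ := ih hz
      exact ⟨q, hsupport.trans (List.suffix_cons ..), hedges.trans (List.suffix_cons ..)⟩

lemma exists_path (p : G.Walk x y) :
    ∃ q : G.Walk x y, q.support.Nodup ∧ q.edges ⊆ p.edges := by
  induction p with
  | nil x hx => exact ⟨nil x hx, by simp [support], List.Subset.refl _⟩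
  | cons x e h p ih =>
    obtain ⟨q, hq, hqp⟩ := ih
    by_cases hx : x ∈ q.support
    · obtain ⟨r, hrsupport, hredges⟩ := exists_suffix q hx
      exact ⟨r, hq.sublist hrsupport.sublist,
        fun a ha => List.mem_cons_of_mem _ (hqp (hredges.subset ha))⟩
    · exact ⟨cons x e h q, List.nodup_cons.2 ⟨hx, hq⟩, List.cons_subset_cons _ hqp⟩

lemma isTrail_of_nodup_support (p : G.Walk x y) (hp : p.support.Nodup) : p.IsTrail := by
  induction p with
  | nil => simp [IsTrail, edges]
  | cons x e h p ih =>
    obtain ⟨hx, hp⟩ := List.nodup_cons.1 hp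
    exact List.nodup_cons.2 ⟨fun he => hx (mem_support_of_inc p e he x h.inc_left), ih hp⟩

lemma exists_link_leaving {A : Set α} (p : G.Walk x y) (hx : x ∈ A) (hy : y ∉ A) :
    ∃ e a b, G.IsLink e a b ∧ a ∈ A ∧ b ∉ A := by
  induction p with
  | nil => exact absurd hx hy
  | @cons w z x e h _ ih =>
    by_cases hw : w ∈ A
    · exact ih hw hy
    · exact ⟨e, x, w, h, hx, hw⟩

end Walks

/-! ### Spanning trees as sparse edge sets -/

section Trees

variable [DecidableEq α] {G T : Graph α β} {x y : α} {F : Finset β} {m : ℕ}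

/-- The map `g` assigns to each edge of `G` its set of ends. -/
def IsEndMap (G : Graph α β) (g : β → Finset α) : Prop :=
  ∀ e x y, G.IsLink e x y → g e = {x, y}

lemma exists_isEndMap (G : Graph α β) : ∃ g, IsEndMap G g := by
  classical
  refine ⟨fun e => if h : ∃ p : α × α, G.IsLink e p.1 p.2 then {h.choose.1, h.choose.2} else ∅,
    fun e x y h => ?_⟩
  have hex : ∃ p : α × α, G.IsLink e p.1 p.2 := ⟨(x, y), h⟩
  simp only [dif_pos hex]
  rcases h.eq_and_eq_or_eq_and_eq hex.choose_spec with ⟨hx, hy⟩ | ⟨hx, hy⟩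
  · rw [← hx, ← hy]
  · rw [← hx, ← hy, pair_comm]

namespace IsEndMap

lemma mono (hg : IsEndMap G g) (h : T ≤ G) : IsEndMap T g :=
  fun e x y he => hg e x y (he.mono h)

lemma mem_iff_inc (hg : IsEndMap G g) {e : β} (he : e ∈ G.edgeSet) {v : α} :
    v ∈ g e ↔ G.Inc e v := by
  obtain ⟨x, y, h⟩ := G.exists_isLink_of_mem_edgeSet he
  rw [hg e x y h, mem_insert, mem_singleton]
  refine ⟨?_, fun hv => hv.eq_or_eq_of_isLink h⟩
  rintro (rfl | rfl)
  exacts [h.inc_left, h.inc_right]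

lemma isMultigraph (hg : IsEndMap G g) [G.Loopless] (hV : G.vertexSet = V)
    (hE : (E : Set β) ⊆ G.edgeSet) : IsMultigraph g E V := by
  refine fun e he => ⟨fun v hv => ?_, ?_⟩
  · exact mem_coe.1 (hV ▸ ((hg.mem_iff_inc (hE he)).1 hv).vertex_mem)
  · obtain ⟨x, y, h⟩ := G.exists_isLink_of_mem_edgeSet (hE he)
    rw [hg e x y h, card_pair h.ne]

end IsEndMap

lemma card_inside_le_add_of_no_crossing {R : α → Prop} [DecidablePred R]
    (hR : ∀ e ∈ inside g F X, (∀ v ∈ g e, R v) ∨ ∀ v ∈ g e, ¬ R v) :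
    #(inside g F X) ≤ #(inside g F {v ∈ X | R v}) + #(inside g F {v ∈ X | ¬ R v}) := by
  classical
  refine (card_le_card fun e he => ?_).trans (card_union_le _ _)
  rw [mem_union, mem_inside, mem_inside]
  have ⟨heF, heX⟩ := mem_inside.1 he
  exact (hR e he).imp (fun h => ⟨heF, fun v hv => mem_filter.2 ⟨heX hv, h v hv⟩⟩)
    fun h => ⟨heF, fun v hv => mem_filter.2 ⟨heX hv, h v hv⟩⟩

lemma exists_walk_of_tight (hg : IsEndMap T g) (hF : (F : Set β) ⊆ T.edgeSet)
    (hs : Sparse 1 g F) (ht : Tight 1 g F X) (hx : x ∈ X) (hy : y ∈ X) (hyT : y ∈ T.vertexSet) :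
    ∃ p : T.Walk x y, ∀ e ∈ p.edges, e ∈ F := by
  classical
  set R : α → Prop := fun v => ∃ p : T.Walk v y, ∀ e ∈ p.edges, e ∈ F
  by_contra hxR
  have hstep {e a b} (he : e ∈ F) (hab : T.IsLink e a b) : R b → R a := fun ⟨p, hp⟩ =>
    ⟨.cons a e hab p, List.forall_mem_cons.2 ⟨he, hp⟩⟩
  have hR : ∀ e ∈ inside g F X, (∀ v ∈ g e, R v) ∨ ∀ v ∈ g e, ¬ R v := by
    intro e he
    have heF := (mem_inside.1 he).1
    obtain ⟨a, b, hab⟩ := T.exists_isLink_of_mem_edgeSet (hF heF)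
    have hiff : R a ↔ R b := ⟨hstep heF hab.symm, hstep heF hab⟩
    simp only [hg e a b hab, mem_insert, mem_singleton, forall_eq_or_imp, forall_eq, hiff]
    tauto
  have hyR : R y := ⟨.nil y hyT, by simp [Graph.Walk.edges]⟩
  have hsplit := card_inside_le_add_of_no_crossing hR
  have hpos := hs {v ∈ X | R v} ⟨y, mem_filter.2 ⟨hy, hyR⟩⟩
  have hneg := hs {v ∈ X | ¬ R v} ⟨x, mem_filter.2 ⟨hx, hxR⟩⟩
  have hcard := card_filter_add_card_filter_not (s := X) (fun v => R v)
  have htight := ht.2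
  omega

lemma not_isCycle_of_sparse (hg : IsEndMap T g) (hF : T.edgeSet ⊆ F) (hs : Sparse 1 g F)
    (p : T.Walk x x) : ¬ p.IsCycle := by
  classical
  rintro ⟨hne, htrail, hnodup⟩
  cases p with
  | nil => exact hne rfl
  | cons x e h p =>
    have hends : (Graph.Walk.cons x e h p).edges.toFinset ⊆ inside g F p.support.toFinset := by
      intro e' he'
      rw [List.mem_toFinset] at he'
      have he'T := mem_edgeSet_of_mem_edges _ e' he'
      refine mem_inside.2 ⟨hF he'T, fun v hv => List.mem_toFinset.2 ?_⟩
      rcases List.mem_cons.1 (mem_support_of_inc _ e' he' v ((hg.mem_iff_inc he'T).1 hv))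
        with rfl | hv
      exacts [end_mem_support p, hv]
    have hcard := card_le_card hends
    have hsparse := hs p.support.toFinset ⟨x, List.mem_toFinset.2 (end_mem_support p)⟩
    rw [List.toFinset_card_of_nodup htrail] at hcard
    rw [List.toFinset_card_of_nodup (l := p.support) hnodup, length_support p] at hsparse
    simp only [Graph.Walk.edges, List.length_cons] at hcard
    omega

lemma isTree_of_sparse_of_tight (hg : IsEndMap T g) (hX : T.vertexSet = X) (hF : T.edgeSet = F)
    (hs : Sparse 1 g F) (ht : Tight 1 g F X) : T.IsTree := by
  refine ⟨⟨hX ▸ ht.1, fun x hx y hy => ?_⟩, fun x p => not_isCycle_of_sparse hg hF.le hs p⟩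
  rw [hX] at hx hy
  exact (exists_walk_of_tight hg hF.ge hs ht hx hy (hX ▸ hy)).nonempty

lemma sparse_of_acyclic (hT : ∀ (x : α) (p : T.Walk x x), ¬ p.IsCycle) (hg : IsEndMap T g)
    (hF : (F : Set β) ⊆ T.edgeSet) : Sparse 1 g F := by
  classical
  induction F using Finset.induction_on with
  | empty => exact sparse_empty
  | insert e F he ih =>
    rw [coe_insert, Set.insert_subset_iff] at hF
    have hs := ih hF.2
    refine hs.insert_of_not_tight fun X hX heX => ?_
    obtain ⟨x, y, hxy⟩ := T.exists_isLink_of_mem_edgeSet hF.1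
    rw [hg e x y hxy, insert_subset_iff, singleton_subset_iff] at heX
    obtain ⟨p, hp⟩ := exists_walk_of_tight hg hF.2 hs hX heX.1 heX.2 hxy.right_mem
    obtain ⟨q, hq, hqp⟩ := exists_path p
    exact hT y (.cons y e hxy.symm q) ⟨List.cons_ne_nil _ _,
      List.nodup_cons.2 ⟨fun h => he (hp e (hqp h)), isTrail_of_nodup_support q hq⟩, hq⟩

lemma tight_of_isConnected (hT : T.IsConnected) (hg : IsEndMap T g) (hX : T.vertexSet = X)
    (hF : T.edgeSet = F) (hs : Sparse 1 g F) (hends : ∀ e ∈ F, #(g e) = 2) :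
    Tight 1 g F X := by
  classical
  obtain ⟨⟨r, hr⟩, hconn⟩ := hT
  rw [hX, mem_coe] at hr
  obtain ⟨A, hA⟩ := exists_maximal (s := {A ∈ X.powerset | Tight 1 g F A})
    ⟨{r}, by simpa using ⟨hr, tight_singleton hends r⟩⟩
  simp only [mem_filter, mem_powerset] at hA
  obtain ⟨⟨hAX, hAne, hAcard⟩, hmax⟩ := hA
  suffices A = X from this ▸ ⟨hAne, hAcard⟩
  by_contra hne
  obtain ⟨b, hbX, hbA⟩ := exists_of_ssubset (hAX.ssubset_of_ne hne)
  obtain ⟨a, ha⟩ := hAne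
  obtain ⟨p⟩ := hconn a (hX ▸ hAX ha) b (hX ▸ hbX)
  obtain ⟨e, u, v, he, hu, hv⟩ := exists_link_leaving (A := A) p ha hbA
  rw [mem_coe] at hu hv
  have hge := hg e u v he
  have heF : e ∈ F := mem_coe.1 (hF ▸ he.edge_mem)
  have hvX : v ∈ X := mem_coe.1 (hX ▸ he.right_mem)
  have heA : e ∉ inside g F A := fun h => hv ((mem_inside.1 h).2 (by simp [hge]))
  have hins : insert e (inside g F A) ⊆ inside g F (insert v A) :=
    insert_subset (mem_inside.2 ⟨heF, by grind⟩) (inside_mono subset_rfl (subset_insert v A))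
  have hcard := card_le_card hins
  have hsparse := hs (insert v A) (insert_nonempty v A)
  rw [card_insert_of_notMem heA] at hcard
  have htight : Tight 1 g F (insert v A) := ⟨insert_nonempty v A, by
    rw [card_insert_of_notMem hv] at hsparse ⊢
    omega⟩
  exact hv (hmax ⟨insert_subset hvX hAX, htight⟩ (subset_insert v A) (mem_insert_self v A))

lemma card_inside_biUnion [DecidableEq β] {ι : Type*} [Fintype ι] {F : ι → Finset β}
    (hF : Pairwise fun i j => Disjoint (F i) (F j)) :
    #(inside g (univ.biUnion F) X) = ∑ i, #(inside g (F i) X) := by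
  rw [inside, filter_biUnion]
  exact card_biUnion fun i _ j _ hij =>
    (hF hij).mono (filter_subset _ _) (filter_subset _ _)

lemma exists_isBase_of_isTreeConnected [G.Loopless] (hm : m ≠ 0) (hG : G.IsTreeConnected m)
    (hg : IsEndMap G g) (hV : G.vertexSet = V) (hE : G.edgeSet = E) :
    ∃ B, IsBase m g E V B := by
  classical
  obtain ⟨T, hT, hdisj⟩ := hG
  have hsub (i) : (T i).edgeSet ⊆ E := hE ▸ (hT i).1.le.edgeSet_mono
  choose F hF using fun i => (E.finite_toSet.subset (hsub i)).exists_finset_coe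
  have hFE (i) : F i ⊆ E := coe_subset.1 (hF i ▸ hsub i)
  have hgT (i) := hg.mono (hT i).1.le
  have hsparse (i) : Sparse 1 g (F i) := sparse_of_acyclic (hT i).2.2 (hgT i) (hF i).le
  have htight (i) : Tight 1 g (F i) V :=
    tight_of_isConnected (hT i).2.1 (hgT i) ((hT i).1.vertexSet_eq.trans hV) (hF i).symm
      (hsparse i) fun e he => (hg.isMultigraph hV hE.ge e (hFE i he)).2
  have hcard (X) : #(inside g (univ.biUnion F) X) = ∑ i, #(inside g (F i) X) :=
    card_inside_biUnion fun i j hij => disjoint_coe.1 (by simpa only [hF] using hdisj i j hij)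
  have hsum (X) : ∑ i, (#(inside g (F i) X) + 1) = #(inside g (univ.biUnion F) X) + m := by
    simp [hcard, sum_add_distrib]
  refine ⟨univ.biUnion F, biUnion_subset.2 fun i _ => hFE i, fun X hX => ?_,
    (htight ⟨0, Nat.pos_of_ne_zero hm⟩).1, ?_⟩
  · calc #(inside g (univ.biUnion F) X) + m = ∑ i, (#(inside g (F i) X) + 1) := (hsum X).symm
      _ ≤ ∑ _i : Fin m, #X := sum_le_sum fun i _ => by simpa using hsparse i X hX
      _ = m * #X := by simp
  · calc #(inside g (univ.biUnion F) V) + m = ∑ i, (#(inside g (F i) V) + 1) := (hsum V).symm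
      _ = ∑ _i : Fin m, #V := sum_congr rfl fun i _ => by simpa using (htight i).2
      _ = m * #V := by simp

lemma IsBase.exists_isTree_restrict [G.Loopless] [DecidableEq β] (hB : IsBase 2 g E V B)
    (hg : IsEndMap G g) (hV : G.vertexSet = V) (hE : G.edgeSet = E) :
    ∃ F₁ F₂ : Finset β, F₁ ∪ F₂ = B ∧ Disjoint F₁ F₂ ∧
      (G.restrict F₁).IsTree ∧ (G.restrict F₂).IsTree := by
  have hBG : (B : Set β) ⊆ G.edgeSet := hE ▸ coe_subset.2 hB.subset
  have hBV : IsMultigraph g B V := hg.isMultigraph hV hBG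
  obtain ⟨F₁, F₂, hunion, hdisj, hF₁, hF₂⟩ := hB.sparse.splitsIntoForests hBV
  have hall {F} (hF : F ⊆ B) : inside g F V = F := inside_eq_self fun e he => (hBV e (hF he)).1
  have hF₁B : F₁ ⊆ B := hunion ▸ subset_union_left
  have hF₂B : F₂ ⊆ B := hunion ▸ subset_union_right
  have hcard₁ := hF₁ V hB.tight.1
  have hcard₂ := hF₂ V hB.tight.1
  have hcard := hB.tight.2
  rw [hall hF₁B] at hcard₁
  rw [hall hF₂B] at hcard₂
  rw [hall subset_rfl, ← hunion, card_union_of_disjoint hdisj] at hcard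
  have htree {F : Finset β} (hF : F ⊆ B) (hs : Sparse 1 g F) (hFV : #F + 1 = 1 * #V) :
      (G.restrict F).IsTree :=
    isTree_of_sparse_of_tight (hg.mono Graph.restrict_le) hV
      (Set.inter_eq_right.2 ((coe_subset.2 hF).trans hBG)) hs ⟨hB.tight.1, by rwa [hall hF]⟩
  exact ⟨F₁, F₂, hunion, hdisj, htree hF₁B hF₁ (by omega), htree hF₂B hF₂ (by omega)⟩

lemma IsBase.isTreeConnected [G.Loopless] (hB : IsBase 2 g E V B) (hg : IsEndMap G g)
    (hV : G.vertexSet = V) (hE : G.edgeSet = E) : G.IsTreeConnected 2 := by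
  classical
  obtain ⟨F₁, F₂, -, hdisj, hF₁, hF₂⟩ := hB.exists_isTree_restrict hg hV hE
  have hdisj : Disjoint (G.restrict F₁).edgeSet (G.restrict F₂).edgeSet := by
    simp only [Graph.edgeSet_restrict]
    exact (disjoint_coe.2 hdisj).mono Set.inter_subset_right Set.inter_subset_right
  refine ⟨![G.restrict F₁, G.restrict F₂], Fin.forall_fin_two.2 ⟨⟨⟨Graph.restrict_le, rfl⟩, hF₁⟩,
    ⟨⟨Graph.restrict_le, rfl⟩, hF₂⟩⟩, fun i j hij => ?_⟩
  fin_cases i <;> fin_cases j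
  exacts [absurd rfl hij, hdisj, hdisj.symm, absurd rfl hij]

end Trees

/-! ### Tree-connected components -/

section Components

variable [DecidableEq α] {C D : Finset α} {F : Finset β} {Q : Finset (Finset α)}

/-- `B` spans `E` in the `k`-sparsity matroid of the multigraph `(V, E)`: every edge of `E` outside
`B` lies in a tight set. -/
def Spans (k : ℕ) (g : β → Finset α) (B E : Finset β) (V : Finset α) : Prop :=
  ∀ e ∈ E, e ∈ B ∨ ∃ X ⊆ V, Tight k g B X ∧ g e ⊆ X

open Classical in
/-- The maximal `k`-tight subsets of `V`. If `B` spans the edges of a graph, these are the vertex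
sets of its `k`-tree-connected components. -/
noncomputable def components (k : ℕ) (g : β → Finset α) (B : Finset β) (V : Finset α) :
    Finset (Finset α) :=
  {C ∈ V.powerset | Maximal (fun X => X ⊆ V ∧ Tight k g B X) C}

/-- The edges of `B` joining different components. -/
noncomputable def cross (k : ℕ) (g : β → Finset α) (B : Finset β) (V : Finset α) : Finset β :=
  {e ∈ B | ∀ C ∈ components k g B V, ¬ g e ⊆ C}

lemma mem_components :
    C ∈ components k g B V ↔ Maximal (fun X => X ⊆ V ∧ Tight k g B X) C := by
  simp only [components, mem_filter, mem_powerset, and_iff_right_iff_imp]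
  exact fun h => h.prop.1

lemma mem_cross {e : β} : e ∈ cross k g B V ↔ e ∈ B ∧ ∀ C ∈ components k g B V, ¬ g e ⊆ C :=
  mem_filter

lemma exists_component_of_tight (hXV : X ⊆ V) (hX : Tight k g B X) :
    ∃ C ∈ components k g B V, X ⊆ C := by
  have hfin : {X | X ⊆ V ∧ Tight k g B X}.Finite :=
    V.powerset.finite_toSet.subset fun X hX => mem_coe.2 (mem_powerset.2 hX.1)
  obtain ⟨C, hXC, hC⟩ := hfin.exists_le_maximal (a := X) ⟨hXV, hX⟩
  exact ⟨C, mem_components.2 hC, hXC⟩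

lemma exists_component_of_mem (hB : ∀ e ∈ B, #(g e) = 2) {v : α} (hv : v ∈ V) :
    ∃ C ∈ components k g B V, v ∈ C := by
  obtain ⟨C, hC, hvC⟩ := exists_component_of_tight (singleton_subset_iff.2 hv)
    (tight_singleton (k := k) hB v)
  exact ⟨C, hC, singleton_subset_iff.1 hvC⟩

lemma Spans.mem_cross (h : Spans k g B E V) {e : β} (he : e ∈ E)
    (hC : ∀ C ∈ components k g B V, ¬ g e ⊆ C) : e ∈ cross k g B V := by
  refine mem_filter.2 ⟨(h e he).resolve_right ?_, hC⟩
  rintro ⟨X, hXV, hX, heX⟩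
  obtain ⟨C, hCV, hXC⟩ := exists_component_of_tight hXV hX
  exact hC C hCV (heX.trans hXC)

lemma eq_of_mem_components (hB : Sparse k g B) (hC : C ∈ components k g B V)
    (hD : D ∈ components k g B V) (hCD : (C ∩ D).Nonempty) : C = D := by
  rw [mem_components] at hC hD
  have hunion : C ∪ D ⊆ V ∧ Tight k g B (C ∪ D) :=
    ⟨union_subset hC.prop.1 hD.prop.1, (hC.prop.2.union_inter hB hD.prop.2 hCD).1⟩
  exact (hC.eq_of_le hunion subset_union_left).trans
    (hD.eq_of_le hunion subset_union_right).symm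

lemma pairwiseDisjoint_components (hB : Sparse k g B) :
    (components k g B V : Set (Finset α)).PairwiseDisjoint id := fun C hC D hD hCD => by
  by_contra hmeet
  rw [Function.onFun, disjoint_iff_inter_eq_empty, ← ne_eq, ← nonempty_iff_ne_empty] at hmeet
  exact hCD (eq_of_mem_components hB hC hD hmeet)

lemma biUnion_components (hB : ∀ e ∈ B, #(g e) = 2) :
    (components k g B V).biUnion id = V := by
  refine Subset.antisymm (biUnion_subset.2 fun C hC => (mem_components.1 hC).prop.1)
    fun v hv => ?_
  obtain ⟨C, hC, hvC⟩ := exists_component_of_mem hB hv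
  exact mem_biUnion.2 ⟨C, hC, hvC⟩

lemma card_biUnion_inside_components [DecidableEq β] (hB : Sparse k g B)
    (hends : ∀ e ∈ B, #(g e) = 2) (hQ : Q ⊆ components k g B V) :
    #(Q.biUnion (inside g B)) + k * #Q = k * ∑ C ∈ Q, #C := by
  have hdisj : (Q : Set (Finset α)).PairwiseDisjoint (inside g B) := by
    refine fun C hC D hD hCD => disjoint_left.2 fun e heC heD => ?_
    rw [mem_inside] at heC heD
    obtain ⟨a, ha⟩ : (g e).Nonempty := card_pos.1 (by rw [hends e heC.1]; omega)
    exact hCD (eq_of_mem_components hB (hQ hC) (hQ hD)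
      ⟨a, mem_inter.2 ⟨heC.2 ha, heD.2 ha⟩⟩)
  rw [card_biUnion hdisj, mul_sum, mul_comm, ← smul_eq_mul, ← sum_const, ← sum_add_distrib]
  exact sum_congr rfl fun C hC => (mem_components.1 (hQ hC)).prop.2.2

lemma disjoint_biUnion_inside_cross [DecidableEq β] (hQ : Q ⊆ components k g B V) :
    Disjoint (Q.biUnion (inside g B)) (cross k g B V) := by
  refine disjoint_left.2 fun e he he' => ?_
  obtain ⟨C, hC, heC⟩ := mem_biUnion.1 he
  exact (mem_cross.1 he').2 C (hQ hC) (mem_inside.1 heC).2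

lemma card_add_mul_card_components (hBV : IsMultigraph g B V) (hB : Sparse k g B) :
    #B + k * #(components k g B V) = k * #V + #(cross k g B V) := by
  classical
  have hends : ∀ e ∈ B, #(g e) = 2 := fun e he => (hBV e he).2
  have hsplit : (components k g B V).biUnion (inside g B) ∪ cross k g B V = B := by
    ext e
    simp only [mem_union, mem_biUnion, mem_inside, mem_cross]
    by_cases h : ∃ C ∈ components k g B V, g e ⊆ C <;> grind
  have hcard := card_union_of_disjoint (disjoint_biUnion_inside_cross (g := g) (B := B)
    (subset_refl (components k g B V)))
  have hinside := card_biUnion_inside_components hB hends (subset_refl (components k g B V))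
  have hV := card_biUnion (pairwiseDisjoint_components (V := V) hB)
  simp only [biUnion_components hends, id] at hV
  rw [hsplit] at hcard
  rw [← hV] at hinside
  omega

lemma mul_card_le_card_cross (hEV : IsMultigraph g E V) (hspan : Spans k g B E V)
    (hB : Sparse k g B) (hFE : F ⊆ E) (hF : Sparse k g F) (hX : Tight k g F X) :
    k * #{C ∈ components k g B V | (C ∩ X).Nonempty} ≤ #(inside g (cross k g B V) X) + k := by
  classical
  set Q := {C ∈ components k g B V | (C ∩ X).Nonempty}
  have hQ {C} : C ∈ Q ↔ C ∈ components k g B V ∧ (C ∩ X).Nonempty := mem_filter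
  have hcover : inside g F X ⊆
      Q.biUnion (fun C => inside g F (C ∩ X)) ∪ inside g (cross k g B V) X := by
    intro e he
    rw [mem_inside] at he
    by_cases h : ∃ C ∈ components k g B V, g e ⊆ C
    · obtain ⟨C, hC, heC⟩ := h
      have heCX := subset_inter heC he.2
      have hne : (g e).Nonempty := card_pos.1 (by rw [(hEV e (hFE he.1)).2]; omega)
      exact mem_union_left _ (mem_biUnion.2 ⟨C, hQ.2 ⟨hC, hne.mono heCX⟩,
        mem_inside.2 ⟨he.1, heCX⟩⟩)
    · push Not at h
      exact mem_union_right _ (mem_inside.2 ⟨hspan.mem_cross (hFE he.1) h, he.2⟩)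
  have hsum : ∑ C ∈ Q, #(inside g F (C ∩ X)) + k * #Q ≤ k * ∑ C ∈ Q, #(C ∩ X) := by
    rw [mul_sum, mul_comm k #Q, ← smul_eq_mul, ← sum_const, ← sum_add_distrib]
    exact sum_le_sum fun C hC => hF (C ∩ X) (hQ.1 hC).2
  have hparts : ∑ C ∈ Q, #(C ∩ X) ≤ #X := by
    have hdisj : (Q : Set (Finset α)).PairwiseDisjoint (· ∩ X) := fun C hC D hD hCD =>
      (pairwiseDisjoint_components hB (hQ.1 hC).1 (hQ.1 hD).1 hCD).mono
        inter_subset_left inter_subset_left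
    rw [← card_biUnion hdisj]
    exact card_le_card (biUnion_subset.2 fun C _ => inter_subset_right)
  have hcard := ((card_le_card hcover).trans (card_union_le _ _)).trans
    (Nat.add_le_add_right card_biUnion_le _)
  have hmul := Nat.mul_le_mul_left k hparts
  have htight := hX.2
  omega

lemma exists_component_of_tight_of_spans (hEV : IsMultigraph g E V) (hBE : B ⊆ E)
    (hB : Sparse k g B) (hspan : Spans k g B E V) (hFE : F ⊆ E) (hF : Sparse k g F)
    (hX : Tight k g F X) (hXV : X ⊆ V) : ∃ C ∈ components k g B V, X ⊆ C := by
  classical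
  set Q := {C ∈ components k g B V | (C ∩ X).Nonempty}
  have hQ : Q ⊆ components k g B V := filter_subset _ _
  have hends : ∀ e ∈ B, #(g e) = 2 := fun e he => (hEV e (hBE he)).2
  have hXQ : X ⊆ Q.biUnion id := fun v hv => by
    obtain ⟨C, hC, hvC⟩ := exists_component_of_mem (k := k) hends (hXV hv)
    exact mem_biUnion.2 ⟨C, mem_filter.2 ⟨hC, v, mem_inter.2 ⟨hvC, hv⟩⟩, hvC⟩
  have hsub : Q.biUnion (inside g B) ∪ inside g (cross k g B V) X ⊆ inside g B (Q.biUnion id) :=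
    union_subset
      (biUnion_subset.2 fun C hC => inside_mono subset_rfl (subset_biUnion_of_mem id hC))
      (inside_mono (filter_subset _ _) hXQ)
  have hcard := card_le_card hsub
  have hdisj : Disjoint (Q.biUnion (inside g B)) (inside g (cross k g B V) X) :=
    (disjoint_biUnion_inside_cross hQ).mono_right (filter_subset _ _)
  rw [card_union_of_disjoint hdisj] at hcard
  have hinside := card_biUnion_inside_components hB hends hQ
  have hcross : k * #Q ≤ _ := mul_card_le_card_cross hEV hspan hB hFE hF hX
  have hne : (Q.biUnion id).Nonempty := hX.1.mono hXQ
  have hsparse := hB _ hne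
  have hsum : k * #(Q.biUnion id) ≤ k * ∑ C ∈ Q, #C := Nat.mul_le_mul_left k card_biUnion_le
  have htight : Tight k g B (Q.biUnion id) := ⟨hne, by omega⟩
  obtain ⟨C, hC, hQC⟩ := exists_component_of_tight
    (biUnion_subset.2 fun C hC => (mem_components.1 (hQ hC)).prop.1) htight
  exact ⟨C, hC, hXQ.trans hQC⟩

end Components

section Omega

variable {G : Graph α β}

lemma loopless_induce [G.Loopless] (X : Set α) : (G.induce X).Loopless :=
  ⟨fun e x h => G.not_isLoopAt e x h.1⟩

variable [DecidableEq α] {C : Finset α}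

lemma IsEndMap.induce (hg : IsEndMap G g) (X : Set α) : IsEndMap (G.induce X) g :=
  fun e x y h => hg e x y h.1

lemma edgeSet_induce_eq_inside (hg : IsEndMap G g) (hE : G.edgeSet = E) :
    (G.induce X).edgeSet = inside g E X := by
  ext e
  rw [Graph.edgeSet_induce, mem_coe, mem_inside]
  constructor
  · rintro ⟨x, y, h, hx, hy⟩
    have heE : e ∈ E := mem_coe.1 (hE ▸ h.edge_mem)
    exact ⟨heE, by simp [hg e x y h, insert_subset_iff, mem_coe.1 hx, mem_coe.1 hy]⟩
  · rintro ⟨he, heX⟩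
    obtain ⟨x, y, h⟩ := G.exists_isLink_of_mem_edgeSet (hE ▸ mem_coe.2 he)
    rw [hg e x y h, insert_subset_iff, singleton_subset_iff] at heX
    exact ⟨x, y, h, heX⟩

lemma isTreeConnected_induce_of_mem_components [G.Loopless] (hg : IsEndMap G g)
    (hE : G.edgeSet = E) (hBE : B ⊆ E) (hB : Sparse 2 g B) (hC : C ∈ components 2 g B V) :
    (G.induce C).IsTreeConnected 2 := by
  have hCt := (mem_components.1 hC).prop.2
  have := loopless_induce (G := G) C
  have hbase : IsBase 2 g (inside g E C) C (inside g B C) := by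
    refine ⟨inside_mono hBE subset_rfl, hB.mono (filter_subset _ _), hCt.1, ?_⟩
    rw [inside_eq_self fun e he => (mem_inside.1 he).2]
    exact hCt.2
  exact hbase.isTreeConnected (hg.induce C) rfl (edgeSet_induce_eq_inside hg hE)

lemma exists_component_of_isTreeConnected_induce [G.Loopless] (hk : k ≠ 0) (hg : IsEndMap G g)
    (hV : G.vertexSet = V) (hE : G.edgeSet = E) (hBE : B ⊆ E) (hB : Sparse k g B)
    (hspan : Spans k g B E V) (hXV : X ⊆ V) (hX : (G.induce X).IsTreeConnected k) :
    ∃ C ∈ components k g B V, X ⊆ C := by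
  have := loopless_induce (G := G) X
  obtain ⟨F, hF⟩ := exists_isBase_of_isTreeConnected hk hX (hg.induce X) rfl
    (edgeSet_induce_eq_inside hg hE)
  exact exists_component_of_tight_of_spans (hg.isMultigraph hV hE.ge) hBE hB hspan
    (hF.subset.trans (filter_subset _ _)) hF.sparse hF.tight hXV

lemma treeComponents_eq_image_components [G.Loopless] (hg : IsEndMap G g)
    (hV : G.vertexSet = V) (hE : G.edgeSet = E) (hBE : B ⊆ E) (hB : Sparse 2 g B)
    (hspan : Spans 2 g B E V) :
    G.treeComponents 2 = (fun C : Finset α => (C : Set α)) '' components 2 g B V := by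
  have htree {C} (hC : C ∈ components 2 g B V) :
      (C : Set α) ⊆ G.vertexSet ∧ (G.induce C).IsTreeConnected 2 :=
    ⟨hV ▸ coe_subset.2 (mem_components.1 hC).prop.1,
      isTreeConnected_induce_of_mem_components hg hE hBE hB hC⟩
  have hsub {X : Set α} (hXV : X ⊆ G.vertexSet) (hX : (G.induce X).IsTreeConnected 2) :
      ∃ C ∈ components 2 g B V, X ⊆ C := by
    rw [hV] at hXV
    lift X to Finset α using V.finite_toSet.subset hXV
    exact exists_component_of_isTreeConnected_induce two_ne_zero hg hV hE hBE hB hspan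
      (coe_subset.1 hXV) hX
  ext X
  constructor
  · intro hX
    rw [Graph.treeComponents, Set.mem_ofPred_eq] at hX
    obtain ⟨C, hC, hXC⟩ := hsub hX.prop.1 hX.prop.2
    exact ⟨C, hC, (hX.eq_of_le (htree hC) hXC).symm⟩
  · rintro ⟨C, hC, rfl⟩
    refine ⟨htree hC, fun Y hY hCY => ?_⟩
    obtain ⟨D, hD, hYD⟩ := hsub hY.1 hY.2
    have hCD : C ⊆ D := coe_subset.1 (hCY.trans hYD)
    rwa [(mem_components.1 hC).eq_of_le (mem_components.1 hD).prop hCD]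

lemma crossEdges_image_components [G.Loopless] (hg : IsEndMap G g)
    (hV : G.vertexSet = V) (hE : G.edgeSet = E) (hBE : B ⊆ E) (hB : Sparse k g B)
    (hspan : Spans k g B E V) :
    G.crossEdges ((fun C : Finset α => (C : Set α)) '' components k g B V)
      = #(cross k g B V) := by
  rw [Graph.crossEdges, ← Set.ncard_coe_finset]
  congr 1
  ext e
  simp only [Set.mem_ofPred_eq, mem_coe, Set.exists_mem_image]
  constructor
  · rintro ⟨x, y, hxy, C, hC, D, hD, hCD, hx, hy⟩
    refine hspan.mem_cross (mem_coe.1 (hE ▸ hxy.edge_mem)) fun A hA heA => hCD ?_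
    rw [hg e x y hxy, insert_subset_iff, singleton_subset_iff] at heA
    rw [eq_of_mem_components hB hC hA ⟨x, mem_inter.2 ⟨hx, heA.1⟩⟩,
      eq_of_mem_components hB hD hA ⟨y, mem_inter.2 ⟨hy, heA.2⟩⟩]
  · intro he
    obtain ⟨heB, hC⟩ := mem_cross.1 he
    have hBV : IsMultigraph g B V := hg.isMultigraph hV (hE ▸ coe_subset.2 hBE)
    obtain ⟨x, y, hxy⟩ := G.exists_isLink_of_mem_edgeSet (hE ▸ mem_coe.2 (hBE heB))
    have heV := (hBV e heB).1
    simp only [hg e x y hxy, insert_subset_iff, singleton_subset_iff] at heV hC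
    obtain ⟨C, hCV, hxC⟩ := exists_component_of_mem (k := k) (fun e he => (hBV e he).2) heV.1
    obtain ⟨D, hDV, hyD⟩ := exists_component_of_mem (k := k) (fun e he => (hBV e he).2) heV.2
    exact ⟨x, y, hxy, C, hCV, D, hDV,
      fun hCD => hC C hCV ⟨hxC, coe_injective hCD ▸ hyD⟩, hxC, hyD⟩

lemma treeOmega_eq [G.Loopless] (hg : IsEndMap G g) (hV : G.vertexSet = V)
    (hE : G.edgeSet = E) (hBE : B ⊆ E) (hB : Sparse 2 g B) (hspan : Spans 2 g B E V) :
    G.treeOmega 2 = (#V : ℝ) - #B / 2 := by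
  have hcard : (#B : ℝ) + 2 * #(components 2 g B V) = 2 * #V + #(cross 2 g B V) := by
    exact_mod_cast card_add_mul_card_components (hg.isMultigraph hV (hE ▸ coe_subset.2 hBE)) hB
  rw [Graph.treeOmega, treeComponents_eq_image_components hg hV hE hBE hB hspan,
    crossEdges_image_components hg hV hE hBE hB hspan,
    Set.ncard_image_of_injective _ coe_injective, Set.ncard_coe_finset]
  push_cast
  linarith

end Omega

/-! ### Spanning closed trails -/

section ClosedTrails

open Graph.Walk

variable {G : Graph α β} {x y z : α} {F₁ F₂ L P : Finset β}

/-- The concatenation of two walks. -/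
def concat : {x y z : α} → G.Walk x y → G.Walk y z → G.Walk x z
  | _, _, _, .nil _ _, q => q
  | _, _, _, .cons x e h p, q => .cons x e h (concat p q)

lemma edges_concat (p : G.Walk x y) (q : G.Walk y z) :
    (concat p q).edges = p.edges ++ q.edges := by
  induction p with
  | nil => rfl
  | cons x e h p ih => simp [concat, edges, ih]

lemma exists_edges_eq_append (p : G.Walk x y) (hz : z ∈ p.support) :
    ∃ (q : G.Walk x z) (r : G.Walk z y), p.edges = q.edges ++ r.edges := by
  induction p with
  | nil x hx =>
    obtain rfl := List.mem_singleton.1 hz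
    exact ⟨nil z hx, nil z hx, rfl⟩
  | cons x e h p ih =>
    rcases List.mem_cons.1 hz with rfl | hz
    · exact ⟨nil z h.left_mem, cons z e h p, rfl⟩
    · obtain ⟨q, r, hqr⟩ := ih hz
      exact ⟨cons x e h q, r, by simp [edges, hqr]⟩

lemma exists_rotate (p : G.Walk x x) (hz : z ∈ p.support) :
    ∃ q : G.Walk z z, q.edges.Perm p.edges := by
  obtain ⟨q, r, hqr⟩ := exists_edges_eq_append p hz
  exact ⟨concat r q, by rw [edges_concat, hqr]; exact List.perm_append_comm⟩

lemma mem_cyclicSupport (p : G.Walk x x) : ∀ v ∈ p.support, v ∈ p.cyclicSupport := by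
  cases p with
  | nil => exact fun v hv => hv
  | cons x e h p => exact List.forall_mem_cons.2 ⟨end_mem_support p, fun v hv => hv⟩

/-- The walk `p` is a trail with edges in `L`, and no such trail is longer. -/
structure IsLongestTrail (L : Finset β) (p : G.Walk x y) : Prop where
  isTrail : p.IsTrail
  mem : ∀ e ∈ p.edges, e ∈ L
  length_le : ∀ (x' y' : α) (q : G.Walk x' y'), q.IsTrail → (∀ e ∈ q.edges, e ∈ L) →
    q.edges.length ≤ p.edges.length

lemma exists_isLongestTrail (hG : G.vertexSet.Nonempty) (L : Finset β) :
    ∃ (x y : α) (p : G.Walk x y), IsLongestTrail L p := by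
  classical
  set N : Set ℕ := {n | ∃ (x y : α) (p : G.Walk x y), p.IsTrail ∧ (∀ e ∈ p.edges, e ∈ L) ∧
    p.edges.length = n}
  have hN : N.Nonempty := by
    obtain ⟨x, hx⟩ := hG
    exact ⟨0, x, x, nil x hx, List.nodup_nil, by simp [edges], rfl⟩
  have hbdd : BddAbove N := by
    refine ⟨#L, ?_⟩
    rintro _ ⟨x, y, p, htrail, hL, rfl⟩
    rw [← List.toFinset_card_of_nodup htrail]
    exact card_le_card fun e he => hL e (List.mem_toFinset.1 he)
  obtain ⟨x, y, p, htrail, hL, hlen⟩ := Nat.sSup_mem hN hbdd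
  exact ⟨x, y, p, htrail, hL, fun x' y' q hq hqL =>
    hlen ▸ le_csSup hbdd ⟨x', y', q, hq, hqL, rfl⟩⟩

lemma IsLongestTrail.mem_edges {p : G.Walk x y} (hp : IsLongestTrail L p) {e : β} (he : e ∈ L)
    (h : G.IsLink e z x) : e ∈ p.edges := by
  by_contra hep
  have := hp.length_le z y (cons z e h p) (List.nodup_cons.2 ⟨hep, hp.isTrail⟩)
    (List.forall_mem_cons.2 ⟨he, hp.mem⟩)
  simp [edges] at this

lemma IsLongestTrail.mem_support {p : G.Walk x x} (hp : IsLongestTrail L p) (hF : F₁ ⊆ L)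
    (hconn : (G.restrict F₁).IsConnected) {v : α} (hv : v ∈ G.vertexSet) : v ∈ p.support := by
  by_contra hvp
  obtain ⟨t⟩ := hconn.2 x (mem_vertexSet_of_mem_support p x (start_mem_support p)) v hv
  obtain ⟨e, a, b, he, ha, hb⟩ :=
    exists_link_leaving (A := {u | u ∈ p.support}) t (start_mem_support p) hvp
  rw [Graph.restrict_isLink] at he
  obtain ⟨q, hq⟩ := exists_rotate p ha
  have hqmax : IsLongestTrail L q :=
    ⟨hq.nodup_iff.2 hp.isTrail, fun e he => hp.mem e (hq.mem_iff.1 he), fun x' y' r hr hrL =>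
      hq.length_eq ▸ hp.length_le x' y' r hr hrL⟩
  exact hb (mem_support_of_inc p e (hq.mem_iff.1 (hqmax.mem_edges (hF he.1) he.2.symm)) b
    he.2.inc_right)

lemma visits_eq_count [DecidableEq α] (p : G.Walk x x) (v : α) :
    p.visits v = p.cyclicSupport.count v := by
  unfold visits
  congr!

lemma visits_le_one {p : G.Walk x x} (hp : p.edges = []) (v : α) : p.visits v ≤ 1 := by
  classical
  cases p with
  | nil => exact le_of_eq_of_le (visits_eq_count _ v) List.count_le_length
  | cons => cases hp

variable [DecidableEq α]

lemma deg_mono (h : B ⊆ B') (v : α) : deg g B v ≤ deg g B' v :=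
  card_le_card (filter_subset_filter _ h)

lemma even_deg_symmDiff [DecidableEq β] (L P : Finset β) (v : α) :
    Even (deg g (symmDiff L P) v) ↔ (Even (deg g L v) ↔ Even (deg g P v)) := by
  have hL := card_sdiff_add_card_inter {e ∈ L | v ∈ g e} {e ∈ P | v ∈ g e}
  have hP := card_sdiff_add_card_inter {e ∈ P | v ∈ g e} {e ∈ L | v ∈ g e}
  rw [inter_comm] at hP
  have hsymm : {e ∈ symmDiff L P | v ∈ g e} = symmDiff {e ∈ L | v ∈ g e} {e ∈ P | v ∈ g e} := by
    ext
    simp only [mem_filter, mem_symmDiff]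
    tauto
  rw [deg, hsymm, symmDiff_def, sup_eq_union, card_union_of_disjoint disjoint_sdiff_sdiff,
    ← Nat.even_add, deg, deg, ← hL, ← hP]
  simp only [Nat.even_iff]
  omega

lemma exists_ne_not_even_deg (hB : IsMultigraph g B V) (hxV : x ∈ V) (hx : ¬ Even (deg g B x)) :
    ∃ y ∈ V, y ≠ x ∧ ¬ Even (deg g B y) := by
  by_contra! hall
  have hsum := sum_deg hB
  rw [← add_sum_erase V _ hxV] at hsum
  have hrest : Even (∑ v ∈ V.erase x, deg g B v) :=
    even_sum _ fun v hv => hall v (mem_of_mem_erase hv) (ne_of_mem_erase hv)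
  exact hx ((Nat.even_add.1 (hsum ▸ even_two_mul _)).2 hrest)

lemma countP_edges_add [G.Loopless] (hg : IsEndMap G g) (p : G.Walk x y) (v : α) :
    p.edges.countP (fun e => v ∈ g e) + (if x = v then 1 else 0) + (if y = v then 1 else 0)
      = 2 * p.support.count v := by
  induction p with
  | nil x hx => by_cases h : x = v <;> simp [edges, support, h]
  | @cons w z x e h p ih =>
    have hends : (if v ∈ g e then 1 else 0)
        = (if x = v then 1 else 0) + (if w = v then 1 else 0) := by
      have hne : x ≠ w := h.ne
      rw [hg e x w h]
      grind
    simp only [edges, support, List.countP_cons, List.count_cons, decide_eq_true_eq, beq_iff_eq]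
    omega

lemma deg_edges_add [DecidableEq β] [G.Loopless] (hg : IsEndMap G g) (p : G.Walk x y)
    (hp : p.IsTrail) (v : α) :
    deg g p.edges.toFinset v + (if x = v then 1 else 0) + (if y = v then 1 else 0)
      = 2 * p.support.count v := by
  have hfilter : {e ∈ p.edges.toFinset | v ∈ g e}
      = (p.edges.filter fun e => v ∈ g e).toFinset := by
    ext
    simp
  rw [← countP_edges_add hg p v, deg, hfilter,
    List.toFinset_card_of_nodup (hp.filter _), List.countP_eq_length_filter]

lemma even_deg_edges_iff [DecidableEq β] [G.Loopless] (hg : IsEndMap G g) (p : G.Walk x y)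
    (hp : p.IsTrail) (hxy : x ≠ y) (v : α) :
    Even (deg g p.edges.toFinset v) ↔ x ≠ v ∧ y ≠ v := by
  have hdeg := deg_edges_add hg p hp v
  rw [Nat.even_iff]
  grind

lemma IsLongestTrail.eq [G.Loopless] {p : G.Walk x y} (hp : IsLongestTrail L p)
    (hg : IsEndMap G g) (hL : (L : Set β) ⊆ G.edgeSet)
    (heven : ∀ v ∈ G.vertexSet, Even (deg g L v)) : x = y := by
  classical
  by_contra hxy
  have hLp : {e ∈ L | x ∈ g e} = {e ∈ p.edges.toFinset | x ∈ g e} := by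
    ext e
    simp only [mem_filter, List.mem_toFinset]
    refine and_congr_left fun hx => ⟨fun he => ?_, hp.mem e⟩
    obtain ⟨z, hz⟩ := (hg.mem_iff_inc (by grind [hp.mem e])).1 hx
    exact hp.mem_edges he hz.symm
  have hx := heven x (mem_vertexSet_of_mem_support p x (start_mem_support p))
  rw [deg, hLp, ← deg, even_deg_edges_iff hg p hp.isTrail hxy] at hx
  exact hx.1 rfl

lemma exists_spanning_closed_trail [G.Loopless] (hg : IsEndMap G g)
    (hL : (L : Set β) ⊆ G.edgeSet) (hF : F₁ ⊆ L) (hconn : (G.restrict F₁).IsConnected)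
    (heven : ∀ v ∈ G.vertexSet, Even (deg g L v)) :
    ∃ (x : α) (p : G.Walk x x), p.IsTrail ∧ (∀ e ∈ p.edges, e ∈ L) ∧
      ∀ v ∈ G.vertexSet, v ∈ p.support := by
  obtain ⟨x, y, p, hp⟩ := exists_isLongestTrail (G := G) hconn.1 L
  obtain rfl := hp.eq hg hL heven
  exact ⟨x, p, hp.isTrail, hp.mem, fun v hv => hp.mem_support hF hconn hv⟩

lemma exists_even_deg_iff_ne [G.Loopless] (hg : IsEndMap G g)
    (hconn : (G.restrict F₂).IsConnected) (hx : x ∈ G.vertexSet) (hy : y ∈ G.vertexSet)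
    (hxy : x ≠ y) :
    ∃ P ⊆ F₂, ∀ v, Even (deg g P v) ↔ x ≠ v ∧ y ≠ v := by
  classical
  obtain ⟨p⟩ := hconn.2 x hx y hy
  obtain ⟨q, hq, -⟩ := exists_path p
  have : (G.restrict F₂).Loopless := Graph.Loopless.anti Graph.restrict_le
  refine ⟨q.edges.toFinset, fun e he => ?_, even_deg_edges_iff (hg.mono Graph.restrict_le) q
    (isTrail_of_nodup_support q hq) hxy⟩
  have := mem_edgeSet_of_mem_edges q e (List.mem_toFinset.1 he)
  rw [Graph.edgeSet_restrict] at this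
  exact this.2

lemma exists_even_between [DecidableEq β] [G.Loopless] (hg : IsEndMap G g) (hV : G.vertexSet = V)
    (hF : ((F₁ ∪ F₂ : Finset β) : Set β) ⊆ G.edgeSet) (hdisj : Disjoint F₁ F₂)
    (hconn : (G.restrict F₂).IsConnected) :
    ∃ L, F₁ ⊆ L ∧ L ⊆ F₁ ∪ F₂ ∧ ∀ v ∈ V, Even (deg g L v) := by
  obtain ⟨L, hL, hmin⟩ := exists_min_image {L ∈ (F₁ ∪ F₂).powerset | F₁ ⊆ L}
    (fun L => #{v ∈ V | ¬ Even (deg g L v)})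
    ⟨F₁, mem_filter.2 ⟨mem_powerset.2 subset_union_left, subset_rfl⟩⟩
  simp only [mem_filter, mem_powerset] at hL hmin
  refine ⟨L, hL.2, hL.1, ?_⟩
  by_contra! hodd
  obtain ⟨x, hxV, hx⟩ := hodd
  obtain ⟨y, hyV, hyx, hy⟩ := exists_ne_not_even_deg
    (hg.isMultigraph hV ((coe_subset.2 hL.1).trans hF)) hxV hx
  obtain ⟨P, hPF, hP⟩ := exists_even_deg_iff_ne hg hconn
    (hV ▸ mem_coe.2 hxV) (hV ▸ mem_coe.2 hyV) hyx.symm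
  have hpar (v : α) : Even (deg g (symmDiff L P) v) ↔ (Even (deg g L v) ↔ x ≠ v ∧ y ≠ v) := by
    rw [even_deg_symmDiff, hP]
  have hmem : symmDiff L P ⊆ F₁ ∪ F₂ ∧ F₁ ⊆ symmDiff L P := by
    refine ⟨fun e he => ?_, fun e he => ?_⟩ <;> rw [mem_symmDiff] at *
    · exact he.elim (fun h => hL.1 h.1) fun h => mem_union_right _ (hPF h.1)
    · exact .inl ⟨hL.2 he, fun h => disjoint_left.1 hdisj he (hPF h)⟩
  refine (hmin _ hmem).not_gt (card_lt_card ((ssubset_iff_of_subset fun v hv => ?_).2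
    ⟨x, mem_filter.2 ⟨hxV, hx⟩, fun h => (mem_filter.1 h).2 ?_⟩))
  · rw [mem_filter, hpar] at hv
    grind
  · rw [hpar]
    simp [hx]

lemma two_mul_visits_le [G.Loopless] (hg : IsEndMap G g) (p : G.Walk x x) (hp : p.IsTrail)
    (hB : ∀ e ∈ p.edges, e ∈ B) (hne : p.edges ≠ []) (v : α) :
    2 * p.visits v ≤ deg g B v := by
  classical
  have hdeg := deg_edges_add hg p hp v
  have hmono : deg g p.edges.toFinset v ≤ deg g B v :=
    deg_mono (fun e he => hB e (List.mem_toFinset.1 he)) v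
  rw [visits_eq_count]
  cases p with
  | nil => exact absurd rfl hne
  | cons x e h p =>
    simp only [support, List.count_cons, beq_iff_eq] at hdeg
    simp only [cyclicSupport]
    omega

theorem IsBase.hasSpanningClosedTrail [G.Loopless] (hB : IsBase 2 g E V B) (hg : IsEndMap G g)
    (hV : G.vertexSet = V) (hE : G.edgeSet = E) {f : α → ℕ} (hf : ∀ v ∈ V, 0 < f v)
    (hdeg : ∀ v ∈ V, deg g B v ≤ 2 * f v + 1) : G.HasSpanningClosedTrail f := by
  classical
  obtain ⟨F₁, F₂, rfl, hdisj, hT₁, hT₂⟩ := hB.exists_isTree_restrict hg hV hE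
  have hBE : ((F₁ ∪ F₂ : Finset β) : Set β) ⊆ G.edgeSet := hE ▸ coe_subset.2 hB.subset
  obtain ⟨L, hFL, hLB, heven⟩ := exists_even_between hg hV hBE hdisj hT₂.1
  obtain ⟨x, p, hp, hpL, hspan⟩ := exists_spanning_closed_trail hg
    ((coe_subset.2 hLB).trans hBE) hFL hT₁.1 (fun v hv => heven v (mem_coe.1 (hV ▸ hv)))
  refine ⟨x, p, hp, fun v hv => ⟨?_, ?_⟩⟩
  · rw [visits_eq_count]
    exact List.count_pos_iff.2 (mem_cyclicSupport p v (hspan v hv))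
  have hvV : v ∈ V := mem_coe.1 (hV ▸ hv)
  by_cases hne : p.edges = []
  · exact (visits_le_one hne v).trans (hf v hvV)
  · have hvisits := two_mul_visits_le hg p hp (fun e he => hLB (hpL e he)) hne v
    have := hdeg v hvV
    omega

end ClosedTrails

/-! ### Deleting a vertex set -/

section Deletion

variable [DecidableEq α] {G : Graph α β} {S : Finset α}

/-- The edges in `B` with no end in `S`. -/
def avoiding (g : β → Finset α) (B : Finset β) (S : Finset α) : Finset β :=
  {e ∈ B | Disjoint (g e) S}

lemma mem_avoiding {e : β} : e ∈ avoiding g B S ↔ e ∈ B ∧ Disjoint (g e) S := mem_filter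

lemma avoiding_add_card_inter {s : Finset α} (hs : #s = 2) (S : Finset α) :
    (if Disjoint s S then 1 else 0) + #(S ∩ s) = 1 + if s ⊆ S then 1 else 0 := by
  have hle : #(S ∩ s) ≤ 2 := hs ▸ card_le_card inter_subset_right
  have hdisj : Disjoint s S ↔ #(S ∩ s) = 0 := by
    rw [disjoint_comm, disjoint_iff_inter_eq_empty, card_eq_zero]
  have hsub : s ⊆ S ↔ #(S ∩ s) = 2 := by
    rw [← inter_eq_right, ← hs]
    exact ⟨congrArg card, eq_of_subset_of_card_le inter_subset_right ∘ Eq.ge⟩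
  simp only [hdisj, hsub]
  split_ifs <;> omega

lemma card_avoiding_add_sum_deg (hB : ∀ e ∈ B, #(g e) = 2) (S : Finset α) :
    #(avoiding g B S) + ∑ v ∈ S, deg g B v = #B + #(inside g B S) := by
  have hcount : ∑ v ∈ S, deg g B v = ∑ e ∈ B, #(S ∩ g e) := by
    simp only [← filter_mem_eq_inter]
    exact sum_card_bipartiteAbove_eq_sum_card_bipartiteBelow fun v e => v ∈ g e
  rw [hcount, avoiding, inside, card_filter, card_filter, ← sum_add_distrib, card_eq_sum_ones,
    ← sum_add_distrib]
  exact sum_congr rfl fun e he => avoiding_add_card_inter (hB e he) S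

lemma inside_avoiding_of_disjoint (hX : Disjoint X S) :
    inside g (avoiding g B S) X = inside g B X := by
  ext e
  simp only [mem_inside, mem_avoiding]
  exact ⟨fun h => ⟨h.1.1, h.2⟩, fun h => ⟨⟨h.1, hX.mono_left h.2⟩, h.2⟩⟩

lemma edgeSet_deleteVerts_eq_avoiding (hg : IsEndMap G g) (hE : G.edgeSet = E) :
    (G.deleteVerts S).edgeSet = avoiding g E S := by
  ext e
  rw [Graph.edgeSet_deleteVerts, mem_coe, mem_avoiding, ← mem_coe, ← hE, Set.mem_ofPred_eq]
  constructor
  · rintro ⟨x, y, h, hx, hy⟩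
    rw [hg e x y h, disjoint_insert_left, disjoint_singleton_left]
    exact ⟨h.edge_mem, hx, hy⟩
  · rintro ⟨he, hdisj⟩
    obtain ⟨x, y, h⟩ := Graph.exists_isLink_of_mem_edgeSet he
    rw [hg e x y h, disjoint_insert_left, disjoint_singleton_left] at hdisj
    exact ⟨x, y, h, hdisj⟩

lemma spans_avoiding (h : ∀ e ∈ E, Disjoint (g e) S →
      e ∈ B ∨ ∃ X ⊆ V, Tight k g B X ∧ g e ⊆ X ∧ Disjoint X S) :
    Spans k g (avoiding g B S) (avoiding g E S) (V \ S) := by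
  intro e he
  rw [mem_avoiding] at he
  refine (h e he.1 he.2).imp (fun heB => mem_avoiding.2 ⟨heB, he.2⟩) ?_
  rintro ⟨X, hXV, hX, heX, hXS⟩
  refine ⟨X, subset_sdiff.2 ⟨hXV, hXS⟩, ?_, heX⟩
  rwa [Tight, inside_avoiding_of_disjoint hXS]

lemma treeOmega_deleteVerts [G.Loopless] (hg : IsEndMap G g) (hV : G.vertexSet = V)
    (hE : G.edgeSet = E) (hBE : B ⊆ E) (hB : Sparse 2 g B)
    (h : ∀ e ∈ E, Disjoint (g e) S →
      e ∈ B ∨ ∃ X ⊆ V, Tight 2 g B X ∧ g e ⊆ X ∧ Disjoint X S) :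
    (G.deleteVerts S).treeOmega 2 = (#(V \ S) : ℝ) - #(avoiding g B S) / 2 := by
  have : (G.deleteVerts S).Loopless := Graph.Loopless.anti Graph.deleteVerts_le
  exact treeOmega_eq (hg.mono Graph.deleteVerts_le)
    (by rw [Graph.vertexSet_deleteVerts, hV, coe_sdiff]) (edgeSet_deleteVerts_eq_avoiding hg hE)
    (filter_subset_filter _ hBE) (hB.mono (filter_subset _ _)) (spans_avoiding h)

lemma card_inside_le_insideEdges (hg : IsEndMap G g) (hE : G.edgeSet = E) (hBE : B ⊆ E)
    (S : Finset α) : #(inside g B S) ≤ G.insideEdges S := by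
  rw [Graph.insideEdges, ← Set.ncard_coe_finset]
  refine Set.ncard_le_ncard (fun e he => ?_) (E.finite_toSet.subset ?_)
  · rw [mem_coe, mem_inside] at he
    obtain ⟨x, y, h⟩ := Graph.exists_isLink_of_mem_edgeSet (hE ▸ mem_coe.2 (hBE he.1))
    rw [hg e x y h, insert_subset_iff, singleton_subset_iff] at he
    exact ⟨x, he.2.1, y, he.2.2, h⟩
  · rintro e ⟨x, -, y, -, h⟩
    exact hE ▸ h.edge_mem

lemma IsBase.card_sdiff_sub_card_avoiding (hE : IsMultigraph g E V) (hB : IsBase 2 g E V B)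
    (hSV : S ⊆ V) :
    (#(V \ S) : ℝ) - #(avoiding g B S) / 2
      = 1 - #S + (∑ v ∈ S, (deg g B v : ℝ)) / 2 - #(inside g B S) / 2 := by
  have hcount : (#(avoiding g B S) : ℝ) + ∑ v ∈ S, (deg g B v : ℝ) = #B + #(inside g B S) :=
    mod_cast card_avoiding_add_sum_deg (fun e he => (hE e (hB.subset he)).2) S
  have hcard : (#B : ℝ) + 2 = 2 * #V := mod_cast hB.card_add hE
  have hVS : (#(V \ S) : ℝ) + #S = #V := mod_cast card_sdiff_add_card_eq_card hSV
  linarith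

theorem IsBase.le_treeOmega_deleteVerts [G.Loopless] (hB : IsBase 2 g E V B) (hg : IsEndMap G g)
    (hV : G.vertexSet = V) (hE : G.edgeSet = E) (hSV : S ⊆ V) {f : α → ℕ}
    (hle : ∀ v ∈ S, 2 * f v + 1 ≤ deg g B v) (hlt : ∃ v ∈ S, 2 * f v + 1 < deg g B v)
    (hspan : ∀ e ∈ E, Disjoint (g e) S →
      e ∈ B ∨ ∃ X ⊆ V, Tight 2 g B X ∧ g e ⊆ X ∧ Disjoint X S)
    {lam : ℝ} (hlam : lam ∈ Set.Icc (0 : ℝ) (1 / 2)) :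
    (∑ v ∈ S, ((f v : ℝ) + 2 * lam - 3 / 2)) + 5 / 2 - lam * ((G.insideEdges S : ℝ) + 2)
      ≤ (G.deleteVerts S).treeOmega 2 := by
  rw [treeOmega_deleteVerts hg hV hE hB.subset hB.sparse hspan,
    hB.card_sdiff_sub_card_avoiding (hg.isMultigraph hV hE.ge) hSV]
  have hdeg : 2 * ∑ v ∈ S, (f v : ℝ) + #S + 1 ≤ ∑ v ∈ S, (deg g B v : ℝ) := by
    have hsum : ∑ v ∈ S, (2 * f v + 1) + 1 ≤ ∑ v ∈ S, deg g B v := sum_lt_sum hle hlt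
    rw [sum_add_distrib, ← mul_sum, ← card_eq_sum_ones] at hsum
    exact_mod_cast hsum
  have hsparse : (#(inside g B S) : ℝ) + 2 ≤ 2 * #S := mod_cast hB.sparse S (hlt.imp fun _ h => h.1)
  have hinside : (#(inside g B S) : ℝ) ≤ G.insideEdges S :=
    mod_cast card_inside_le_insideEdges hg hE hB.subset S
  -- `i / 2 = (1 / 2 - lam) * i + lam * i`, where the two copies of `i` are bounded differently
  have hsparse' := mul_le_mul_of_nonneg_left hsparse (sub_nonneg.2 hlam.2)
  have hinside' := mul_le_mul_of_nonneg_left hinside hlam.1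
  rw [sum_sub_distrib, sum_add_distrib, sum_const, sum_const, nsmul_eq_mul, nsmul_eq_mul]
  linarith

end Deletion

end TreeConnectivity

open TreeConnectivity in
theorem mainTheorem6 {α β : Type*} (G : Graph α β) (hV : G.vertexSet.Finite)
    (hE : G.edgeSet.Finite) (hloop : G.Loopless) (hG : Graph.IsTreeConnected 2 G)
    (lam : ℝ) (hlam : lam ∈ Set.Icc (0 : ℝ) (1 / 2))
    (f : α → ℕ) (hf : ∀ v ∈ G.vertexSet, 0 < f v)
    (hS : ∀ S : Finset α, (S : Set α) ⊆ G.vertexSet →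
      Graph.treeOmega 2 (G.deleteVerts (S : Set α)) <
        (∑ v ∈ S, ((f v : ℝ) + 2 * lam - 3 / 2)) + 5 / 2
          - lam * ((G.insideEdges (S : Set α) : ℝ) + 2)) :
    G.HasSpanningClosedTrail f := by
  classical
  obtain ⟨V, hV⟩ := hV.exists_finset_coe
  obtain ⟨E, hE⟩ := hE.exists_finset_coe
  obtain ⟨g, hg⟩ := exists_isEndMap G
  rw [← hV] at hf hS
  rcases exists_bounded_or_obstruction two_ne_zero (hg.isMultigraph hV.symm hE.le)
      (exists_isBase_of_isTreeConnected two_ne_zero hG hg hV.symm hE.symm) (fun v => 2 * f v + 1)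
    with ⟨B, hB, hdeg⟩ | ⟨B, hB, S, hSV, hle, hlt, hspan⟩
  · exact hB.hasSpanningClosedTrail hg hV.symm hE.symm hf hdeg
  · exact absurd (hS S (Finset.coe_subset.2 hSV))
      (hB.le_treeOmega_deleteVerts hg hV.symm hE.symm hSV hle hlt hspan hlam).not_gt
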